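/- Let $\mathbb K$ be a normed division algebra: a nonzero finite-dimensional real unital algebra, possibly nonassociative, with a conjugation $*$ such that $a^{**}=a$, $(ab)^*=b^*a^*$, with $\mathrm{Re}(a)=\frac12(a+a^*)\in\mathbb R$, and such that $|a|=\sqrt{aa^*}$ is a positive definite multiplicative norm. (Examples are $\mathbb R,\mathbb C,\mathbb H,\mathbb O$.) For a hermitian $2\times2$ matrix $A$ over $\mathbb K$ put $\tilde A=A-(\mathrm{tr}A)1$, and let $\mathcal V$ be the space of $4\times 4$ matrices $\mathcal A=\begin{pmatrix}a&\tilde A\\A&-a\end{pmatrix}$ with $a\in\mathbb R$ and $A$ hermitian, with the Minkowski metric $h(\mathcal A,\mathcal A)=a^2-\det A$. Let $\mathcal S=\mathbb K^4$, on which $\mathcal V$ acts by left multiplication (the Clifford action), with the pairing $\langle\Psi,\Phi\rangle=\mathrm{Re}(\Psi^\dagger\Gamma^0\Phi)$, $\Gamma^0=\begin{pmatrix}0&-1\\1&0\end{pmatrix}$. Let $\Psi\cdot\Phi\in\mathcal V$ be the vector with $h(\Psi\cdot\Phi,\mathcal A)=\langle\Psi,\mathcal A\Phi\rangle$ for all $\mathcal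 A\in\mathcal V$. The supertranslation algebra $\mathcal T=\mathcal V\oplus\mathcal S$ is the Lie superalgebra with even part $\mathcal V$, odd part $\mathcal S$, whose only nonzero bracket is $[\Psi,\Phi]=\Psi\cdot\Phi$ on spinors. An $L_\infty$-superalgebra consists of super vector spaces $V_0,V_1,V_2,\dots$ and parity-preserving multilinear maps $l_k$ ($k\ge1$) of degree $k-2$ on their direct sum, graded-antisymmetric (with signs given by degree plus parity) and satisfying the generalized Jacobi identities; it is a Lie $n$-superalgebra if $V_p=0$ for $p\ge n$. If only $V_0$ and $V_n$ are nonzero and $d=l_1=0$, it corresponds to the quadruple $(\mathfrak g,R,\rho,l_{n+2})$, where $\mathfrak g=V_0$ is a Lie superalgebra with bracket $l_2$, $R=V_n$, $\rho(x)f=l_2(x,f)$ is a representation, and $l_{n+2}$ is an even $(n+2)$-cocycle on $\mathfrak g$ with values in $R$. A Lie $n$-superalgebra is exact if only $V_0$ and $V_{n-1}$ are nonzero, $d=0$, and the cocycle $l_{n+1}$ is a Chevalley--Eilenberg coboundary. Then $\dim\mathcal V=\dim\mathbb K+3$; in particular $\dim\mathcal V=4,5,7,11$ for $\mathbb K=\mathbb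 R,\mathbb C,\mathbb H,\mathbb O$. There is a unique $(2,2)$-form $\beta$ on $\mathcal T$ (a real-valued super-skew-symmetric $4$-linear map that, on homogeneous arguments, vanishes unless two are vectors and two are spinors) with $$\beta(\Psi,\Phi,\mathcal A,\mathcal B)=\langle\Psi,(\mathcal A\mathcal B-\mathcal B\mathcal A)\Phi\rangle,$$ the commutator being taken in the Clifford algebra of $\mathcal V$; it is an even $4$-cocycle with values in the trivial representation $\mathbb R$. There exists a non-exact Lie $3$-superalgebra, concentrated in degrees $0$ and $2$ with $d=0$, that corresponds to the quadruple $(\mathcal T,\mathbb R,\text{trivial representation},\beta)$. It is an extension of $\mathcal T$: there is a short exact sequence of $L_\infty$-superalgebras $0\to \mathrm b^2\mathbb R\to L\to\mathcal T\to0$, where $\mathrm b^2\mathbb R$ is $\mathbb R$ in degree $2$ with all operations zero. -/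

import Mathlib

open scoped Quaternion Matrix DirectSum

/-! ## Normed division algebras -/

/-- A normed division algebra: a nonzero finite-dimensional real unital algebra, not assumed
associative or commutative, with a conjugation `star` (`a** = a`, `(ab)* = b* a*`), real part
`Re a = (a + a*) / 2 ∈ ℝ 1`, and norm `|a| = √(a a*)` that is positive definite and multiplicative
(both stated for the square `a a* ∈ ℝ 1` of the norm). -/
class NormedDivisionAlgebra (K : Type*) [NonAssocRing K] [StarRing K] [Module ℝ K]
    [IsScalarTower ℝ K K] [SMulCommClass ℝ K K] [StarModule ℝ K] where
  nontrivial : Nontrivial K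
  finite : Module.Finite ℝ K
  /-- The real part. -/
  re : K →ₗ[ℝ] ℝ
  re_smul_one : ∀ a : K, re a • (1 : K) = (2⁻¹ : ℝ) • (a + star a)
  normSq_pos : ∀ a : K, a ≠ 0 → 0 < re (a * star a)
  normSq_mul : ∀ a b : K,
    re ((a * b) * star (a * b)) = re (a * star a) * re (b * star b)

instance : NormedDivisionAlgebra ℝ where
  nontrivial := inferInstance
  finite := inferInstance
  re := LinearMap.id
  re_smul_one a := by
    simp only [star_trivial, LinearMap.id_apply, smul_eq_mul]
    ring
  normSq_pos a ha := by simpa using ha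
  normSq_mul a b := by
    simp only [star_trivial, LinearMap.id_apply]
    ring

noncomputable instance : NormedDivisionAlgebra ℂ where
  nontrivial := inferInstance
  finite := inferInstance
  re := Complex.reLm
  re_smul_one a := by
    apply Complex.ext
    · simp; ring
    · simp
  normSq_pos a ha := by
    have h := Complex.normSq_pos.2 ha
    rw [Complex.normSq_apply] at h
    simpa using h
  normSq_mul a b := by
    simp
    ring

instance : StarModule ℝ ℍ[ℝ] where
  star_smul r a := by ext <;> simp

/-- The real part of a quaternion. -/
def Quaternion.reLinear : ℍ[ℝ] →ₗ[ℝ] ℝ where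
  toFun a := a.re
  map_add' _ _ := rfl
  map_smul' _ _ := rfl

theorem Quaternion.reLinear_apply (a : ℍ[ℝ]) : Quaternion.reLinear a = a.re := rfl

noncomputable instance : NormedDivisionAlgebra ℍ[ℝ] where
  nontrivial := inferInstance
  finite := inferInstance
  re := Quaternion.reLinear
  re_smul_one a := by
    ext <;> simp [Quaternion.reLinear_apply]
    ring
  normSq_pos a ha := by
    have h : 0 < Quaternion.normSq a :=
      lt_of_le_of_ne Quaternion.normSq_nonneg (Ne.symm (Quaternion.normSq_ne_zero.2 ha))
    simpa [Quaternion.normSq_def, Quaternion.reLinear_apply] using h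
  normSq_mul a b := by
    simp [Quaternion.reLinear_apply]
    ring

/-- The octonions, as pairs of quaternions (Cayley–Dickson construction). -/
def Octonion : Type := ℍ[ℝ] × ℍ[ℝ]

namespace Octonion

instance : AddCommGroup Octonion := inferInstanceAs (AddCommGroup (ℍ[ℝ] × ℍ[ℝ]))
instance : Module ℝ Octonion := inferInstanceAs (Module ℝ (ℍ[ℝ] × ℍ[ℝ]))
instance : Module.Finite ℝ Octonion := inferInstanceAs (Module.Finite ℝ (ℍ[ℝ] × ℍ[ℝ]))
instance : Nontrivial Octonion := inferInstanceAs (Nontrivial (ℍ[ℝ] × ℍ[ℝ]))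

@[ext] theorem ext {x y : Octonion} (h₁ : x.1 = y.1) (h₂ : x.2 = y.2) : x = y := Prod.ext h₁ h₂

noncomputable instance : One Octonion := ⟨((1 : ℍ[ℝ]), (0 : ℍ[ℝ]))⟩

/-- `(a, b) (c, d) = (a c - d* b, d a + b c*)`. -/
noncomputable instance : Mul Octonion :=
  ⟨fun x y => (x.1 * y.1 - star y.2 * x.2, y.2 * x.1 + x.2 * star y.1)⟩

/-- `(a, b)* = (a*, -b)`. -/
instance : Star Octonion := ⟨fun x => (star x.1, -x.2)⟩

@[simp] theorem one_fst : (1 : Octonion).1 = 1 := rfl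
@[simp] theorem one_snd : (1 : Octonion).2 = 0 := rfl
@[simp] theorem zero_fst : (0 : Octonion).1 = 0 := rfl
@[simp] theorem zero_snd : (0 : Octonion).2 = 0 := rfl
@[simp] theorem add_fst (x y : Octonion) : (x + y).1 = x.1 + y.1 := rfl
@[simp] theorem add_snd (x y : Octonion) : (x + y).2 = x.2 + y.2 := rfl
@[simp] theorem smul_fst (r : ℝ) (x : Octonion) : (r • x).1 = r • x.1 := rfl
@[simp] theorem smul_snd (r : ℝ) (x : Octonion) : (r • x).2 = r • x.2 := rfl
@[simp] theorem mul_fst (x y : Octonion) : (x * y).1 = x.1 * y.1 - star y.2 * x.2 := rfl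
@[simp] theorem mul_snd (x y : Octonion) : (x * y).2 = y.2 * x.1 + x.2 * star y.1 := rfl
@[simp] theorem star_fst (x : Octonion) : (star x).1 = star x.1 := rfl
@[simp] theorem star_snd (x : Octonion) : (star x).2 = -x.2 := rfl

noncomputable instance : NonAssocRing Octonion :=
  { (inferInstance : AddCommGroup Octonion), (inferInstance : Mul Octonion),
    (inferInstance : One Octonion) with
    left_distrib := fun a b c => by
      ext1
      · simp only [mul_fst, add_fst, add_snd, star_add, mul_add, add_mul]; abel
      · simp only [mul_snd, add_fst, add_snd, star_add, mul_add, add_mul]; abel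
    right_distrib := fun a b c => by
      ext1
      · simp only [mul_fst, add_fst, add_snd, mul_add, add_mul]; abel
      · simp only [mul_snd, add_fst, add_snd, mul_add, add_mul]; abel
    zero_mul := fun a => by ext1 <;> simp
    mul_zero := fun a => by ext1 <;> simp
    one_mul := fun a => by ext1 <;> simp
    mul_one := fun a => by ext1 <;> simp }

noncomputable instance : StarRing Octonion where
  star_involutive a := by ext1 <;> simp
  star_mul a b := by
    ext1
    · simp
    · simp only [star_snd, mul_snd, star_fst, star_star]
      rw [neg_mul, neg_mul, neg_add, add_comm]
  star_add a b := by
    ext1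
    · simp
    · simp only [star_snd, add_snd]; abel

instance : IsScalarTower ℝ Octonion Octonion where
  smul_assoc r x y := by
    ext1
    · simp [smul_sub]
    · simp [smul_add]

instance : SMulCommClass ℝ Octonion Octonion where
  smul_comm r x y := by
    ext1
    · simp [smul_sub]
    · simp [smul_add]

instance : StarModule ℝ Octonion where
  star_smul r x := by ext1 <;> simp

/-- The real part of an octonion. -/
def reLinear : Octonion →ₗ[ℝ] ℝ where
  toFun x := x.1.re
  map_add' _ _ := rfl
  map_smul' _ _ := rfl

theorem reLinear_apply (x : Octonion) : reLinear x = x.1.re := rfl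

theorem reLinear_mul_star (x : Octonion) :
    reLinear (x * star x) = Quaternion.normSq x.1 + Quaternion.normSq x.2 := by
  simp [reLinear_apply, Quaternion.normSq_def']
  ring

noncomputable instance : NormedDivisionAlgebra Octonion where
  nontrivial := inferInstance
  finite := inferInstance
  re := reLinear
  re_smul_one x := by
    apply Octonion.ext
    · ext <;> simp [reLinear_apply]
      ring
    · simp
  normSq_pos x hx := by
    rw [reLinear_mul_star]
    by_contra h
    have h1 := Quaternion.normSq_nonneg (a := x.1)
    have h2 := Quaternion.normSq_nonneg (a := x.2)
    apply hx
    apply Octonion.ext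
    · exact Quaternion.normSq_eq_zero.1 (by linarith)
    · exact Quaternion.normSq_eq_zero.1 (by linarith)
  normSq_mul x y := by
    rw [reLinear_mul_star, reLinear_mul_star, reLinear_mul_star]
    simp [Quaternion.normSq_def']
    ring

end Octonion

/-! ## Vectors and spinors in `dim K + 3` dimensions -/

section Spacetime

variable (K : Type*) [NonAssocRing K] [StarRing K] [Module ℝ K] [IsScalarTower ℝ K K]
  [SMulCommClass ℝ K K] [StarModule ℝ K]

/-- The hermitian `2 × 2` matrices over `K`. -/
abbrev Herm : Type _ := selfAdjoint.submodule ℝ (Matrix (Fin 2) (Fin 2) K)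

/-- Vectors in `dim K + 3` dimensions; `(a, A)` stands for the `4 × 4` matrix with blocks
`a, Ã` and `A, -a` (see `Vec.toMatrix`). -/
abbrev Vec : Type _ := ℝ × Herm K

/-- Spinors in `dim K + 3` dimensions: `K⁴ = K² ⊕ K²`. -/
abbrev Spinor : Type _ := Fin 2 ⊕ Fin 2 → K

variable {K}

/-- Trace reversal `Ã = A - (tr A) 1`. -/
def traceReversal (A : Matrix (Fin 2) (Fin 2) K) : Matrix (Fin 2) (Fin 2) K :=
  A - Matrix.diagonal fun _ => A.trace

theorem traceReversal_mem {A : Matrix (Fin 2) (Fin 2) K}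
    (hA : A ∈ selfAdjoint.submodule ℝ (Matrix (Fin 2) (Fin 2) K)) :
    traceReversal A ∈ selfAdjoint.submodule ℝ (Matrix (Fin 2) (Fin 2) K) := by
  have h : star A = A := hA
  have h' : star A.trace = A.trace := by
    conv_rhs => rw [← h]
    simp [Matrix.trace, Matrix.star_apply]
  change star (traceReversal A) = traceReversal A
  simp only [traceReversal, star_sub, h]
  rw [Matrix.star_eq_conjTranspose, Matrix.diagonal_conjTranspose]
  congr 2
  funext i
  simp [h']

/-- The `4 × 4` matrix of a vector. -/
def Vec.toMatrix (v : Vec K) : Matrix (Fin 2 ⊕ Fin 2) (Fin 2 ⊕ Fin 2) K :=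
  Matrix.fromBlocks (v.1 • 1) (traceReversal v.2.1) v.2.1 (-(v.1 • 1))

/-- The Clifford action of vectors on spinors, `Γ(v) Ψ = v Ψ`. -/
def cliffordAction (v : Vec K) : Module.End ℝ (Spinor K) where
  toFun Ψ := v.toMatrix *ᵥ Ψ
  map_add' Ψ Φ := Matrix.mulVec_add _ Ψ Φ
  map_smul' r Ψ := by
    simp [Matrix.mulVec_smul]

variable [NormedDivisionAlgebra K]

open NormedDivisionAlgebra (re)

/-- `-det A`, that is `-t² + x² + |y|²` for the hermitian matrix with rows `t + x, y` and
`y*, t - x`. -/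
def minkowskiSq (A : Herm K) : ℝ :=
  re (A.1 0 1 * star (A.1 0 1)) - re (A.1 0 0) * re (A.1 1 1)

/-- The Minkowski metric `g` on hermitian matrices, the polarization of `-det`. -/
noncomputable def metric₂ (A B : Herm K) : ℝ :=
  (minkowskiSq (A + B) - minkowskiSq A - minkowskiSq B) / 2

/-- The Minkowski metric `h` on vectors, with `h((a, A), (a, A)) = g(A, A) + a²`. -/
noncomputable def metric (v w : Vec K) : ℝ := metric₂ v.2 w.2 + v.1 * w.1

/-- The matrix `Γ⁰`. -/
def gammaZero : Matrix (Fin 2 ⊕ Fin 2) (Fin 2 ⊕ Fin 2) K := Matrix.fromBlocks 0 (-1) 1 0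

/-- The pairing of spinors `⟨Ψ, Φ⟩ = Re (Ψ† Γ⁰ Φ)`. -/
def spinorPairing (Ψ Φ : Spinor K) : ℝ := re (star Ψ ⬝ᵥ (gammaZero *ᵥ Φ))

/-- `ψ φ† + φ ψ†` for `ψ, φ ∈ K²`. -/
def hermOuter (ψ φ : Fin 2 → K) : Herm K :=
  ⟨Matrix.vecMulVec ψ (star φ) + Matrix.vecMulVec φ (star ψ), by
    change star _ = _
    ext i j
    simp [Matrix.star_apply, Matrix.vecMulVec_apply, add_comm]⟩

/-- The bracket of spinors `Ψ · Φ`; its characterization is `metric_spinorDot`. -/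
def spinorDot (Ψ Φ : Spinor K) : Vec K :=
  (re (star (Ψ ∘ Sum.inl) ⬝ᵥ (Φ ∘ Sum.inr)) + re (star (Φ ∘ Sum.inl) ⬝ᵥ (Ψ ∘ Sum.inr)),
    -⟨traceReversal (hermOuter (Ψ ∘ Sum.inl) (Φ ∘ Sum.inl)).1, traceReversal_mem (hermOuter _ _).2⟩
      + hermOuter (Ψ ∘ Sum.inr) (Φ ∘ Sum.inr))

/-! ### The metric is nondegenerate and characterizes the bracket of spinors -/

theorem re_eq_of_smul_one {r s : ℝ} (h : r • (1 : K) = s • (1 : K)) : r = s := by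
  have := NormedDivisionAlgebra.nontrivial (K := K)
  exact smul_left_injective ℝ (one_ne_zero (α := K)) h

theorem re_star (a : K) : re (star a) = re a := by
  apply re_eq_of_smul_one (K := K)
  rw [NormedDivisionAlgebra.re_smul_one, NormedDivisionAlgebra.re_smul_one, star_star, add_comm]

theorem re_one : re (1 : K) = 1 := by
  apply re_eq_of_smul_one (K := K)
  rw [NormedDivisionAlgebra.re_smul_one, star_one, ← two_smul ℝ (1 : K), smul_smul]
  norm_num

theorem smul_one_of_star_eq {a : K} (h : star a = a) : re a • (1 : K) = a := by
  rw [NormedDivisionAlgebra.re_smul_one, h, ← two_smul ℝ a, smul_smul]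
  norm_num

theorem star_eq_sub (a : K) : star a = (2 * re a) • (1 : K) - a := by
  rw [mul_smul, NormedDivisionAlgebra.re_smul_one, smul_smul]
  norm_num

theorem re_mul_star_comm (a b : K) : re (a * star b) = re (b * star a) := by
  rw [← re_star, star_mul, star_star]

theorem re_mul_mul_star (a b c : K) :
    re ((a * b) * star (a * c)) = re (a * star a) * re (b * star c) := by
  have h := NormedDivisionAlgebra.normSq_mul a (b + c)
  have h1 := NormedDivisionAlgebra.normSq_mul a b
  have h2 := NormedDivisionAlgebra.normSq_mul a c
  have h3 := re_mul_star_comm (a * b) (a * c)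
  have h4 := re_mul_star_comm b c
  simp only [mul_add, add_mul, star_add, map_add] at h h1 h2 h3 h4 ⊢
  linear_combination (h - h1 - h2 + h3 - re (a * star a) * h4) / 2

theorem re_mul_star_left (a b c : K) :
    re ((a * b) * star c) = re (b * star (star a * c)) := by
  have h := re_mul_mul_star (a + 1) b c
  have h1 := re_mul_mul_star a b c
  simp only [add_mul, one_mul, star_add, mul_add, map_add, star_one, mul_one, re_one,
    re_star] at h
  rw [star_eq_sub a, sub_mul, smul_mul_assoc, one_mul, star_sub, star_smul, mul_sub,
    mul_smul_comm, map_sub, map_smul]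
  simp only [star_trivial, smul_eq_mul]
  linear_combination h - h1

theorem re_star_mul (x y : K) : re (star x * y) = re (x * star y) := by
  have h := re_star y
  rw [star_eq_sub x, star_eq_sub y]
  simp only [sub_mul, mul_sub, smul_mul_assoc, mul_smul_comm, one_mul, mul_one, map_sub,
    map_smul, smul_eq_mul]
  ring

theorem re_mul_star_right (a b c : K) :
    re ((a * b) * star c) = re (a * star (c * star b)) := by
  have h := re_mul_star_left (star b) (star a) (star c)
  rw [star_star, star_star, star_mul, star_star, re_star_mul] at h
  rw [← re_star_mul, star_mul, h]

theorem metric₂_eq (A B : Herm K) :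
    metric₂ A B = re (A.1 0 1 * star (B.1 0 1))
      - (re (A.1 0 0) * re (B.1 1 1) + re (B.1 0 0) * re (A.1 1 1)) / 2 := by
  have h := re_mul_star_comm (A.1 0 1) (B.1 0 1)
  simp only [metric₂, minkowskiSq, Submodule.coe_add, Matrix.add_apply, star_add, mul_add,
    add_mul, map_add]
  linear_combination -h / 2

theorem Herm.star_apply (A : Herm K) (i j : Fin 2) : star (A.1 i j) = A.1 j i :=
  congrFun (congrFun (show star A.1 = A.1 from A.2) j) i

theorem metric_spinorDot (Ψ Φ : Spinor K) (v : Vec K) :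
    metric (spinorDot Ψ Φ) v = spinorPairing Ψ (cliffordAction v Φ) := by
  obtain ⟨a, A⟩ := v
  have h00 : A.1 0 0 = re (A.1 0 0) • (1 : K) := (smul_one_of_star_eq (Herm.star_apply A 0 0)).symm
  have h11 : A.1 1 1 = re (A.1 1 1) • (1 : K) := (smul_one_of_star_eq (Herm.star_apply A 1 1)).symm
  have h10 : A.1 1 0 = star (A.1 0 1) := (Herm.star_apply A 0 1).symm
  have f (x y z : K) : re (x * (star y * star z)) = re ((x * star y) * star z) := by
    rw [re_mul_star_right, star_star, star_mul]
  have e (x y z : K) : re (x * (star y * z)) = re ((y * star x) * star z) := by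
    rw [re_mul_star_right y (star x) z, star_star]
    have h1 := re_mul_star_left (star z) y x
    rw [star_star, re_mul_star_comm, star_mul, star_star] at h1
    exact h1
  rw [metric, metric₂_eq]
  simp only [spinorDot, spinorPairing, cliffordAction, Vec.toMatrix, gammaZero]
  simp [Matrix.mulVec, dotProduct, traceReversal, hermOuter, Matrix.vecMulVec_apply, Matrix.trace,
    Matrix.one_apply, re_star_mul]
  rw [h00, h11, h10]
  simp only [mul_add, add_mul, neg_mul, mul_neg, map_add, map_neg, map_smul, smul_eq_mul, re_one,
    star_one, mul_one, star_star, mul_smul_comm, star_smul, star_trivial, f, e]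
  have c1 := re_mul_star_comm (Ψ (Sum.inl 0)) (Φ (Sum.inl 0))
  have c2 := re_mul_star_comm (Ψ (Sum.inl 1)) (Φ (Sum.inl 1))
  have c3 := re_mul_star_comm (Ψ (Sum.inr 0)) (Φ (Sum.inr 0))
  have c4 := re_mul_star_comm (Ψ (Sum.inr 1)) (Φ (Sum.inr 1))
  have c5 := re_mul_star_comm (Ψ (Sum.inr 0)) (Φ (Sum.inl 0))
  have c6 := re_mul_star_comm (Ψ (Sum.inr 1)) (Φ (Sum.inl 1))
  linear_combination (re (A.1 0 0) / 2) * (c1 + c4) + (re (A.1 1 1) / 2) * (c2 + c3)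
    - a * (c5 + c6)

theorem eq_of_metric_eq {v w : Vec K} (h : ∀ u, metric v u = metric w u) : v = w := by
  have hM (p q : ℝ) (y : K) : !![p • 1, y; star y, q • 1] ∈
      selfAdjoint.submodule ℝ (Matrix (Fin 2) (Fin 2) K) := by
    change star _ = _
    ext i j
    fin_cases i <;> fin_cases j <;> simp [Matrix.star_apply]
  have h1 := h (1, 0)
  have h2 (p q : ℝ) (y : K) := h (0, ⟨_, hM p q y⟩)
  simp only [metric, metric₂_eq] at h1 h2
  simp [re_one] at h1 h2
  have hp := h2 1 0 0
  have hq := h2 0 1 0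
  have hy := h2 0 0 (v.2.1 0 1 - w.2.1 0 1)
  simp at hp hq hy
  have e01 : v.2.1 0 1 = w.2.1 0 1 := by
    by_contra hne
    have := NormedDivisionAlgebra.normSq_pos _ (sub_ne_zero.2 hne)
    rw [sub_mul, map_sub] at this
    rw [star_sub] at this
    linarith
  have r (A : Herm K) (i : Fin 2) : A.1 i i = re (A.1 i i) • (1 : K) :=
    (smul_one_of_star_eq (Herm.star_apply A i i)).symm
  refine Prod.ext h1 (Subtype.ext ?_)
  ext i j
  fin_cases i <;> fin_cases j
  · change v.2.1 0 0 = w.2.1 0 0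
    rw [r v.2 0, r w.2 0, hq]
  · exact e01
  · change v.2.1 1 0 = w.2.1 1 0
    rw [← Herm.star_apply v.2 0 1, ← Herm.star_apply w.2 0 1, e01]
  · change v.2.1 1 1 = w.2.1 1 1
    rw [r v.2 1, r w.2 1, hp]

end Spacetime

/-! ## Lie superalgebras and their cohomology -/

/-- A super vector space: a real vector space that is the direct sum of an even and an odd part. -/
class SuperSpace (W : Type*) [AddCommGroup W] [Module ℝ W] where
  even : Submodule ℝ W
  odd : Submodule ℝ W
  isCompl : IsCompl even odd

/-- The homogeneous elements of parity `p`. -/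
def SuperSpace.part (W : Type*) [AddCommGroup W] [Module ℝ W] [SuperSpace W] (p : ZMod 2) :
    Submodule ℝ W :=
  if p = 0 then SuperSpace.even else SuperSpace.odd

/-- The real line, purely even. -/
instance : SuperSpace ℝ := ⟨⊤, ⊥, isCompl_top_bot⟩

/-- The sign `(-1)^p`. -/
def paritySign (p : ZMod 2) : ℝ := if p = 0 then 1 else -1

/-- The Koszul sign `ε(σ; x₁, …, xₙ)` for elements `xᵢ` of grade `d i`, given by
`x₁ ⋯ xₙ = ε(σ) x_σ(1) ⋯ x_σ(n)` in the free graded-commutative algebra. -/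
def koszulSign {n : ℕ} (σ : Equiv.Perm (Fin n)) (d : Fin n → ZMod 2) : ℝ :=
  ∏ a, ∏ b, if a < b ∧ σ b < σ a then paritySign (d (σ a) * d (σ b)) else 1

/-- `χ(σ) = sgn(σ) ε(σ)`. -/
def chi {n : ℕ} (σ : Equiv.Perm (Fin n)) (d : Fin n → ZMod 2) : ℝ :=
  ((Equiv.Perm.sign σ : ℤ) : ℝ) * koszulSign σ d

/-- A Lie superalgebra over `ℝ`. -/
class LieSuperalgebra (g : Type*) [AddCommGroup g] [Module ℝ g] extends SuperSpace g where
  bracket : g →ₗ[ℝ] g →ₗ[ℝ] g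
  bracket_mem : ∀ (p q : ZMod 2) (x y : g), x ∈ SuperSpace.part g p → y ∈ SuperSpace.part g q →
    bracket x y ∈ SuperSpace.part g (p + q)
  bracket_skew : ∀ (p q : ZMod 2) (x y : g), x ∈ SuperSpace.part g p → y ∈ SuperSpace.part g q →
    bracket x y = -(paritySign (p * q) • bracket y x)
  jacobi : ∀ (p q : ZMod 2) (x y z : g), x ∈ SuperSpace.part g p → y ∈ SuperSpace.part g q →
    bracket x (bracket y z) =
      bracket (bracket x y) z + paritySign (p * q) • bracket y (bracket x z)

/-- A representation of a Lie superalgebra `g` on a super vector space `R`. -/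
structure SuperRepresentation (g R : Type*) [AddCommGroup g] [Module ℝ g] [LieSuperalgebra g]
    [AddCommGroup R] [Module ℝ R] [SuperSpace R] where
  map : g →ₗ[ℝ] R →ₗ[ℝ] R
  map_mem : ∀ (p q : ZMod 2) (x : g) (r : R), x ∈ SuperSpace.part g p →
    r ∈ SuperSpace.part R q → map x r ∈ SuperSpace.part R (p + q)
  map_bracket : ∀ (p q : ZMod 2) (x y : g) (r : R), x ∈ SuperSpace.part g p →
    y ∈ SuperSpace.part g q →
    map (LieSuperalgebra.bracket x y) r = map x (map y r) - paritySign (p * q) • map y (map x r)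

/-- The trivial representation. -/
def SuperRepresentation.trivial (g R : Type*) [AddCommGroup g] [Module ℝ g] [LieSuperalgebra g]
    [AddCommGroup R] [Module ℝ R] [SuperSpace R] : SuperRepresentation g R where
  map := 0
  map_mem _ _ _ _ _ _ := Submodule.zero_mem _
  map_bracket _ _ _ _ _ _ _ := by simp

section Cochains

variable {g R : Type*} [AddCommGroup g] [Module ℝ g] [SuperSpace g]
  [AddCommGroup R] [Module ℝ R] [SuperSpace R]

/-- `ω` is an `n`-cochain (a super-skew-symmetric `n`-linear map) of parity `s`; it is even if
`s = 0` and odd if `s = 1`. -/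
structure IsCochain {n : ℕ} (ω : MultilinearMap ℝ (fun _ : Fin n => g) R) (s : ZMod 2) :
    Prop where
  skew : ∀ (σ : Equiv.Perm (Fin n)) (x : Fin n → g) (p : Fin n → ZMod 2),
    (∀ i, x i ∈ SuperSpace.part g (p i)) → ω (fun i => x (σ i)) = chi σ p • ω x
  parity : ∀ (x : Fin n → g) (p : Fin n → ZMod 2),
    (∀ i, x i ∈ SuperSpace.part g (p i)) → ω x ∈ SuperSpace.part R (s + ∑ i, p i)

/-- The value at homogeneous elements `x i` of parity `p i` of the coboundary `dω` of an
`(n + 1)`-cochain `ω` of parity `s`, for a bracket `br` and an action `ρ`. Indices start at `0`.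
In the second sum `x i` and `x j`, `i < j`, are removed from the arguments and their bracket is
put in front. -/
def coboundary (br : g → g → g) (ρ : g → R → R) {n : ℕ}
    (ω : MultilinearMap ℝ (fun _ : Fin (n + 1) => g) R) (s : ZMod 2)
    (x : Fin (n + 2) → g) (p : Fin (n + 2) → ZMod 2) : R :=
  (∑ i : Fin (n + 2),
    ((-1 : ℝ) ^ (i : ℕ) * paritySign (p i * s) * paritySign (p i * ∑ a with a < i, p a)) •
      ρ (x i) (ω fun t => x (i.succAbove t))) +
  ∑ i : Fin (n + 1), ∑ j : Fin (n + 2), if i.castSucc < j then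
    ((-1 : ℝ) ^ ((i : ℕ) + (j : ℕ)) * paritySign (p i.castSucc * p j) *
        paritySign (p i.castSucc * ∑ a with a < i.castSucc, p a) *
        paritySign (p j * ∑ a with a < j, p a)) •
      ω (Fin.cons (br (x i.castSucc) (x j)) fun t => x (j.succAbove (i.succAbove t)))
  else 0

/-- The cochain `ω` of parity `s` is a cocycle: `dω = 0`. -/
def IsCocycle (br : g → g → g) (ρ : g → R → R) {n : ℕ}
    (ω : MultilinearMap ℝ (fun _ : Fin (n + 1) => g) R) (s : ZMod 2) : Prop :=
  IsCochain ω s ∧ ∀ (x : Fin (n + 2) → g) (p : Fin (n + 2) → ZMod 2),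
    (∀ i, x i ∈ SuperSpace.part g (p i)) → coboundary br ρ ω s x p = 0

/-- `ω` is trivial (exact): `ω = dθ` for some cochain `θ`, written as the sum of its even part
`θ₀` and its odd part `θ₁`. -/
def IsTrivialCocycle (br : g → g → g) (ρ : g → R → R) {n : ℕ}
    (ω : MultilinearMap ℝ (fun _ : Fin (n + 2) => g) R) : Prop :=
  ∃ θ₀ θ₁ : MultilinearMap ℝ (fun _ : Fin (n + 1) => g) R, IsCochain θ₀ 0 ∧ IsCochain θ₁ 1 ∧
    ∀ (x : Fin (n + 2) → g) (p : Fin (n + 2) → ZMod 2),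
      (∀ i, x i ∈ SuperSpace.part g (p i)) →
      ω x = coboundary br ρ θ₀ 0 x p + coboundary br ρ θ₁ 1 x p

end Cochains

/-! ## The supertranslation algebra and the `(2, 2)`-form -/

section Supertranslation

variable (K : Type*) [NonAssocRing K] [StarRing K] [Module ℝ K] [IsScalarTower ℝ K K]
  [SMulCommClass ℝ K K] [StarModule ℝ K] [NormedDivisionAlgebra K]

/-- The supertranslation algebra: vectors are even, spinors are odd. -/
abbrev Supertranslation : Type _ := Vec K × Spinor K

variable {K}

theorem spinorDot_comm (Ψ Φ : Spinor K) : spinorDot Ψ Φ = spinorDot Φ Ψ := by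
  have h (ψ φ : Fin 2 → K) : hermOuter ψ φ = hermOuter φ ψ := Subtype.ext (add_comm _ _)
  simp only [spinorDot, h, add_comm]

theorem metric_add_left (u v w : Vec K) : metric (u + v) w = metric u w + metric v w := by
  simp only [metric, metric₂_eq, Prod.fst_add, Prod.snd_add, Submodule.coe_add, Matrix.add_apply,
    map_add, add_mul]
  ring

theorem metric_smul_left (r : ℝ) (v w : Vec K) : metric (r • v) w = r * metric v w := by
  simp only [metric, metric₂_eq, Prod.smul_fst, Prod.smul_snd, Submodule.coe_smul,
    Matrix.smul_apply, map_smul, smul_mul_assoc, smul_eq_mul]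
  ring

theorem spinorDot_add_right (Ψ Φ Φ' : Spinor K) :
    spinorDot Ψ (Φ + Φ') = spinorDot Ψ Φ + spinorDot Ψ Φ' := by
  apply eq_of_metric_eq
  intro u
  rw [metric_add_left, metric_spinorDot, metric_spinorDot, metric_spinorDot, map_add]
  simp only [spinorPairing, Matrix.mulVec_add, dotProduct_add, map_add]

theorem spinorDot_smul_right (r : ℝ) (Ψ Φ : Spinor K) :
    spinorDot Ψ (r • Φ) = r • spinorDot Ψ Φ := by
  apply eq_of_metric_eq
  intro u
  rw [metric_smul_left, metric_spinorDot, metric_spinorDot, map_smul]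
  simp only [spinorPairing, Matrix.mulVec_smul, dotProduct_smul, map_smul, smul_eq_mul]

/-- The bracket: `[(v, Ψ), (w, Φ)] = (Ψ · Φ, 0)`. -/
def supertranslationBracket :
    Supertranslation K →ₗ[ℝ] Supertranslation K →ₗ[ℝ] Supertranslation K :=
  LinearMap.mk₂ ℝ (fun x y => (spinorDot x.2 y.2, 0))
    (fun x x' y => by
      simp [spinorDot_comm _ y.2, spinorDot_add_right])
    (fun r x y => by
      simp [spinorDot_comm _ y.2, spinorDot_smul_right])
    (fun x y y' => by simp [spinorDot_add_right])
    (fun r x y => by simp [spinorDot_smul_right])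

instance : SuperSpace (Supertranslation K) where
  even := Submodule.prod ⊤ ⊥
  odd := Submodule.prod ⊥ ⊤
  isCompl := by
    constructor
    · rw [Submodule.disjoint_def]
      rintro ⟨v, Ψ⟩ h h'
      simp_all
    · rw [codisjoint_iff, eq_top_iff]
      rintro ⟨v, Ψ⟩ -
      refine Submodule.mem_sup.2 ⟨(v, 0), by simp, (0, Ψ), by simp, by simp⟩

theorem supertranslationBracket_apply (x y : Supertranslation K) :
    supertranslationBracket x y = (spinorDot x.2 y.2, 0) := rfl

theorem spinorDot_zero_right (Ψ : Spinor K) : spinorDot Ψ 0 = 0 := by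
  simpa using spinorDot_smul_right 0 Ψ 0

theorem spinorDot_zero_left (Ψ : Spinor K) : spinorDot 0 Ψ = 0 := by
  rw [spinorDot_comm, spinorDot_zero_right]

theorem mem_part_zero {x : Supertranslation K} :
    x ∈ SuperSpace.part (Supertranslation K) 0 ↔ x.2 = 0 := by
  simp [SuperSpace.part, SuperSpace.even]

theorem mem_part_one {x : Supertranslation K} :
    x ∈ SuperSpace.part (Supertranslation K) 1 ↔ x.1 = 0 := by
  simp [SuperSpace.part, SuperSpace.odd]

noncomputable instance : LieSuperalgebra (Supertranslation K) where
  bracket := supertranslationBracket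
  bracket_mem p q x y hx hy := by
    rw [supertranslationBracket_apply]
    by_cases hp : p = 0
    · rw [hp] at hx
      rw [mem_part_zero.1 hx, spinorDot_zero_left]
      exact Submodule.zero_mem _
    by_cases hq : q = 0
    · rw [hq] at hy
      rw [mem_part_zero.1 hy, spinorDot_zero_right]
      exact Submodule.zero_mem _
    have h : p + q = 0 :=
      (by decide : ∀ p q : ZMod 2, p ≠ 0 → q ≠ 0 → p + q = 0) p q hp hq
    rw [h, mem_part_zero]
  bracket_skew p q x y hx hy := by
    rw [supertranslationBracket_apply, supertranslationBracket_apply]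
    by_cases hp : p = 0
    · rw [hp] at hx
      rw [mem_part_zero.1 hx, spinorDot_zero_left, spinorDot_zero_right]
      simp
    by_cases hq : q = 0
    · rw [hq] at hy
      rw [mem_part_zero.1 hy, spinorDot_zero_left, spinorDot_zero_right]
      simp
    have h : p * q ≠ 0 :=
      (by decide : ∀ p q : ZMod 2, p ≠ 0 → q ≠ 0 → p * q ≠ 0) p q hp hq
    rw [paritySign, if_neg h, spinorDot_comm]
    simp
  jacobi p q x y z _ _ := by
    simp [supertranslationBracket_apply, spinorDot_zero_left, spinorDot_zero_right]

/-- `β` is the `(2, 2)`-form (a cochain that vanishes on homogeneous arguments unless exactly two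
of them are vectors and two are spinors) with `β(Ψ, Φ, v, w) = ⟨Ψ, (v w - w v) Φ⟩`, the
commutator being taken in the Clifford algebra. -/
structure IsMembraneForm (β : MultilinearMap ℝ (fun _ : Fin 4 => Supertranslation K) ℝ) :
    Prop where
  isCochain : IsCochain β 0
  eq_zero : ∀ (x : Fin 4 → Supertranslation K) (p : Fin 4 → ZMod 2),
    (∀ i, x i ∈ SuperSpace.part (Supertranslation K) (p i)) →
    Finset.card {i | p i = 1} ≠ 2 → β x = 0
  apply : ∀ (Ψ Φ : Spinor K) (v w : Vec K),
    β ![(0, Ψ), (0, Φ), (v, 0), (w, 0)] =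
      spinorPairing Ψ (⁅cliffordAction v, cliffordAction w⁆ Φ)

end Supertranslation

/-! ## `L∞`-superalgebras -/

/-- An `L∞`-superalgebra: super vector spaces `V 0, V 1, V 2, …` and multilinear maps `l k`,
`k ≥ 1`, on their direct sum, of degree `k - 2`, preserving parity, graded-antisymmetric and
satisfying the generalized Jacobi identity. The sign conventions use the overall grade, the sum
of degree and parity. The value `l 0` is a placeholder. -/
structure LInftySuperalgebra.{u} where
  V : ℕ → Type u
  [addCommGroup : ∀ q, AddCommGroup (V q)]
  [module : ∀ q, Module ℝ (V q)]
  [superSpace : ∀ q, SuperSpace (V q)]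
  l : ∀ k : ℕ, MultilinearMap ℝ (fun _ : Fin k => ⨁ q, V q) (⨁ q, V q)
  l_zero : l 0 = 0
  degree : ∀ (k : ℕ) (q : Fin k → ℕ) (x : ∀ i, V (q i)) (r : ℕ), r + 2 ≠ (∑ i, q i) + k →
    l k (fun i => DirectSum.of V (q i) (x i)) r = 0
  parity : ∀ (k : ℕ) (q : Fin k → ℕ) (p : Fin k → ZMod 2) (x : ∀ i, V (q i)),
    (∀ i, x i ∈ SuperSpace.part (V (q i)) (p i)) →
    ∀ r, l k (fun i => DirectSum.of V (q i) (x i)) r ∈ SuperSpace.part (V r) (∑ i, p i)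
  antisymm : ∀ (k : ℕ) (q : Fin k → ℕ) (p : Fin k → ZMod 2) (x : ∀ i, V (q i)),
    (∀ i, x i ∈ SuperSpace.part (V (q i)) (p i)) → ∀ σ : Equiv.Perm (Fin k),
    l k (fun i => DirectSum.of V (q (σ i)) (x (σ i))) =
      chi σ (fun i => (q i : ZMod 2) + p i) • l k (fun i => DirectSum.of V (q i) (x i))
  /-- The outer sum is over the number `i + 1` of arguments of the inner operation; `σ` runs over
  the unshuffles, increasing on the first `i + 1` and on the last `n - (i + 1)` positions. -/
  jacobi : ∀ (n : ℕ) (q : Fin n → ℕ) (p : Fin n → ZMod 2) (x : ∀ i, V (q i)),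
    (∀ i, x i ∈ SuperSpace.part (V (q i)) (p i)) →
    ∑ i : Fin n, ∑ σ : Equiv.Perm (Fin n) with
        (∀ a b : Fin n, a < b → (b : ℕ) < i + 1 → σ a < σ b) ∧
        (∀ a b : Fin n, a < b → (i : ℕ) + 1 ≤ a → σ a < σ b),
      (chi σ (fun a => (q a : ZMod 2) + p a) * (-1 : ℝ) ^ (((i : ℕ) + 1) * (n - (i + 1)))) •
        l (n - i) (fun t =>
          if (t : ℕ) = 0 then
            l (i + 1) (fun s =>
              DirectSum.of V (q (σ ⟨s, by omega⟩)) (x (σ ⟨s, by omega⟩)))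
          else
            DirectSum.of V (q (σ ⟨i + t, by omega⟩)) (x (σ ⟨i + t, by omega⟩))) = 0

namespace LInftySuperalgebra

attribute [instance] addCommGroup module superSpace

/-- A Lie `n`-superalgebra: all nonzero terms have degree `< n`. -/
def IsLieSuperalgebra (L : LInftySuperalgebra) (n : ℕ) : Prop := ∀ q, n ≤ q → Subsingleton (L.V q)

/-- Only `V 0` and `V n` are nonzero, and `d = l 1` vanishes. -/
def IsTwoTerm (L : LInftySuperalgebra) (n : ℕ) : Prop :=
  (∀ q, q ≠ 0 → q ≠ n → Subsingleton (L.V q)) ∧ L.l 1 = 0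

/-- The bracket `[x, y]` on `V 0`. -/
def bracket (L : LInftySuperalgebra) (x y : L.V 0) : L.V 0 :=
  L.l 2 ![DirectSum.of L.V 0 x, DirectSum.of L.V 0 y] 0

/-- The action `[x, f]` of `V 0` on `V n`. -/
def action (L : LInftySuperalgebra) (n : ℕ) (x : L.V 0) (f : L.V n) : L.V n :=
  L.l 2 ![DirectSum.of L.V 0 x, DirectSum.of L.V n f] n

/-- The `(n + 2)`-cochain on `V 0` with values in `V n` that is given by `l (n + 2)`. -/
def topCochain (L : LInftySuperalgebra) (n : ℕ) :
    MultilinearMap ℝ (fun _ : Fin (n + 2) => L.V 0) (L.V n) :=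
  (DirectSum.component ℝ ℕ L.V n).compMultilinearMap
    ((L.l (n + 2)).compLinearMap fun _ => DirectSum.lof ℝ ℕ L.V 0)

/-- The Lie `(n + 1)`-superalgebra `L` is exact: only `V 0` and `V n` are nonzero, with `d = 0`,
and the `(n + 2)`-cocycle `l (n + 2)` on `V 0` with values in `V n` is trivial. -/
def IsExact (L : LInftySuperalgebra) (n : ℕ) : Prop :=
  L.IsLieSuperalgebra (n + 1) ∧ L.IsTwoTerm n ∧
    IsTrivialCocycle L.bracket (L.action n) (L.topCochain n)

/-- A parity-preserving linear isomorphism. -/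
def _root_.LinearEquiv.IsSuper {W W' : Type*} [AddCommGroup W] [Module ℝ W] [SuperSpace W]
    [AddCommGroup W'] [Module ℝ W'] [SuperSpace W'] (e : W ≃ₗ[ℝ] W') : Prop :=
  ∀ (p : ZMod 2) (x : W), x ∈ SuperSpace.part W p ↔ e x ∈ SuperSpace.part W' p

section Correspondence

variable {g R : Type*} [AddCommGroup g] [Module ℝ g] [LieSuperalgebra g]
  [AddCommGroup R] [Module ℝ R] [SuperSpace R]

/-- `L` consists of two terms `V 0` and `V n`, has `d = 0`, and corresponds to the quadruple
`(g, R, ρ, ω)`: up to parity-preserving isomorphisms, `V 0` with its bracket is `g`, `V n` is `R`,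
the action `[x, f]` is `ρ`, and `l (n + 2)` is `ω`. -/
def CorrespondsTo (L : LInftySuperalgebra) (n : ℕ) (ρ : SuperRepresentation g R)
    (ω : MultilinearMap ℝ (fun _ : Fin (n + 2) => g) R) : Prop :=
  L.IsTwoTerm n ∧ ∃ (e₀ : g ≃ₗ[ℝ] L.V 0) (e₁ : R ≃ₗ[ℝ] L.V n), e₀.IsSuper ∧ e₁.IsSuper ∧
    (∀ x y, L.bracket (e₀ x) (e₀ y) = e₀ (LieSuperalgebra.bracket x y)) ∧
    (∀ x r, L.action n (e₀ x) (e₁ r) = e₁ (ρ.map x r)) ∧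
    ∀ x : Fin (n + 2) → g, L.topCochain n (fun i => e₀ (x i)) = e₁ (ω x)

variable (g R)

/-- `L` is the Lie superalgebra `g`, regarded as an `L∞`-superalgebra in degree `0`. -/
def IsOfLie (L : LInftySuperalgebra) : Prop :=
  (∀ q, q ≠ 0 → Subsingleton (L.V q)) ∧ ∃ e : g ≃ₗ[ℝ] L.V 0, e.IsSuper ∧
    ∀ x y, L.bracket (e x) (e y) = e (LieSuperalgebra.bracket x y)

/-- `L` is `bⁿR`: the super vector space `R` in degree `n`, with all operations zero. -/
def IsShift (L : LInftySuperalgebra) (n : ℕ) : Prop :=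
  (∀ q, q ≠ n → Subsingleton (L.V q)) ∧ (∀ k, L.l k = 0) ∧ ∃ e : R ≃ₗ[ℝ] L.V n, e.IsSuper

end Correspondence

/-- A (strict) homomorphism of `L∞`-superalgebras. -/
structure Hom (L M : LInftySuperalgebra) where
  map : ∀ q, L.V q →ₗ[ℝ] M.V q
  map_mem : ∀ (q : ℕ) (p : ZMod 2) (x : L.V q), x ∈ SuperSpace.part (L.V q) p →
    map q x ∈ SuperSpace.part (M.V q) p
  map_l : ∀ (k : ℕ) (x : Fin k → ⨁ q, L.V q),
    DirectSum.lmap map (L.l k x) = M.l k (fun i => DirectSum.lmap map (x i))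

/-- `L` is an extension of the Lie superalgebra `g` by `bⁿR`: there is a short exact sequence
`0 → bⁿR → L → g → 0` of `L∞`-superalgebras. -/
def IsExtension.{u, v, w} (L : LInftySuperalgebra.{u}) (n : ℕ) (g : Type v) (R : Type w)
    [AddCommGroup g] [Module ℝ g] [LieSuperalgebra g] [AddCommGroup R] [Module ℝ R] [SuperSpace R] : Prop :=
  ∃ (A B : LInftySuperalgebra.{u}) (ι : Hom A L) (π : Hom L B), A.IsShift R n ∧ B.IsOfLie g ∧
    ∀ q, Function.Injective (ι.map q) ∧ Function.Exact (ι.map q) (π.map q) ∧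
      Function.Surjective (π.map q)

end LInftySuperalgebra

/-! The heart of the matter is the identity `Ψ · ((Ψ · Ψ) Ψ) = 0` for a single spinor `Ψ`, which
follows from `a (a* b) = |a|² b`, that is, from alternativity of `K`. Together with
`⟨Ψ, 𝒜 Φ⟩ = h(Ψ · Φ, 𝒜)` it gives `⟨Ψ, [Ψ · Ψ, 𝒜] Ψ⟩ = 0`, and since the left side is a quartic
form in `Ψ`, polarization turns this into the only component of `dβ = 0` that is not void, the one
with four spinors and one vector.

With only `l₂` and `l₄` nonzero and `l₄` supported on degree `0`, the generalized Jacobi identities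
become the Jacobi identity and the cocycle condition: up to sign, the sum over unshuffles is the
Chevalley–Eilenberg differential. If the bracket vanishes on every pair among the arguments, then
so does every coboundary with trivial coefficients; two spinors with `Ψ · Φ = 0` and two vectors
at which `β` does not vanish therefore show that `β` is not a coboundary.
-/

section Spacetime

variable {K : Type*} [NonAssocRing K] [StarRing K] [Module ℝ K] [IsScalarTower ℝ K K]
  [SMulCommClass ℝ K K] [StarModule ℝ K] [NormedDivisionAlgebra K]

open NormedDivisionAlgebra (re)

/-- A hermitian matrix is given by its diagonal entries and its upper right entry. -/
def hermEquiv : Herm K ≃ₗ[ℝ] ℝ × ℝ × K where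
  toFun A := (re (A.1 0 0), re (A.1 1 1), A.1 0 1)
  map_add' A B := by simp
  map_smul' r A := by simp
  invFun x := ⟨!![x.1 • 1, x.2.2; star x.2.2, x.2.1 • 1], by
    change star _ = _
    ext i j
    fin_cases i <;> fin_cases j <;> simp [Matrix.star_apply]⟩
  left_inv A := by
    apply Subtype.ext
    ext i j
    fin_cases i <;> fin_cases j <;> simp [smul_one_of_star_eq, Herm.star_apply]
  right_inv x := by simp [re_one]

theorem finrank_vec : Module.finrank ℝ (Vec K) = Module.finrank ℝ K + 3 := by
  have := NormedDivisionAlgebra.finite (K := K)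
  have : Module.Finite ℝ (Herm K) := Module.Finite.equiv hermEquiv.symm
  rw [Module.finrank_prod, hermEquiv.finrank_eq, Module.finrank_prod, Module.finrank_prod,
    Module.finrank_self]
  ring

theorem finrank_octonion : Module.finrank ℝ Octonion = 8 := by
  change Module.finrank ℝ (ℍ[ℝ] × ℍ[ℝ]) = 8
  rw [Module.finrank_prod, Quaternion.finrank_eq_four]

theorem mul_star_self_eq_smul_one (a : K) : a * star a = re (a * star a) • (1 : K) :=
  (smul_one_of_star_eq (by rw [star_mul, star_star])).symm

theorem eq_of_re_mul_star_eq {a b : K} (h : ∀ c, re (a * star c) = re (b * star c)) : a = b := by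
  by_contra hne
  have hpos := NormedDivisionAlgebra.normSq_pos _ (sub_ne_zero.2 hne)
  rw [sub_mul, map_sub, h, sub_self] at hpos
  exact lt_irrefl _ hpos

theorem re_mul_mul_star_right (a b c : K) :
    re ((b * a) * star (c * a)) = re (a * star a) * re (b * star c) := by
  have h := re_mul_mul_star (star a) (star b) (star c)
  rw [← star_mul b a, ← star_mul c a] at h
  simpa only [re_star_mul, star_star] using h

theorem re_mul_assoc (a b c : K) : re ((a * b) * c) = re (a * (b * c)) := by
  simpa only [star_mul, star_star] using re_mul_star_right a b (star c)

theorem re_mul_comm (a b : K) : re (a * b) = re (b * a) := by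
  simpa only [star_star, re_star_mul] using re_mul_star_comm a (star b)

theorem mul_star_mul_cancel (a b : K) : (a * star b) * b = re (b * star b) • a := by
  refine eq_of_re_mul_star_eq fun c => ?_
  rw [re_mul_star_right, ← star_star b, star_star (star b), re_mul_mul_star_right,
    star_star, re_star_mul, smul_mul_assoc, map_smul, smul_eq_mul]

theorem mul_mul_star_add (a b c : K) :
    (a * b) * star c + (a * c) * star b = (2 * re (b * star c)) • a := by
  have polar := mul_star_mul_cancel a (star b + star c)
  have hb := mul_star_mul_cancel a (star b)
  have hc := mul_star_mul_cancel a (star c)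
  simp only [star_add, star_star, mul_add, add_mul, map_add, re_star_mul,
    re_mul_star_comm c b] at polar hb hc
  rw [hb, hc] at polar
  rw [← sub_eq_zero] at polar ⊢
  rw [← polar]
  module

theorem mul_star_mul_add (a b c : K) :
    b * (star c * a) + c * (star b * a) = (2 * re (b * star c)) • a := by
  have h := congrArg star (mul_mul_star_add (star a) b c)
  simp only [star_add, star_mul, star_star, star_smul, star_trivial] at h
  rw [← h, add_comm]

theorem re_mul_star_mul_mul_star (a b c : K) :
    re (((a * star b) * c) * star a) = re (a * star a) * re (c * star b) := by
  rw [re_mul_star_right, re_mul_mul_star, star_star, re_star_mul, re_mul_star_comm b]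

/-- `(φ φ†) ψ - Re (φ† ψ) φ`. Both halves of the spinor `(Ψ · Ψ) Ψ` have this form, see
`cliffordAction_spinorDot_self`. -/
def outerResidue (φ ψ : Fin 2 → K) : Fin 2 → K := fun i =>
  ∑ j, (φ i * star (φ j)) * ψ j - (∑ j, re (φ j * star (ψ j))) • φ i

theorem re_outerResidue_mul_star_self (φ ψ : Fin 2 → K) (i : Fin 2) :
    re (outerResidue φ ψ i * star (φ i)) = 0 := by
  simp only [outerResidue, sub_mul, Finset.sum_mul, map_sub, map_sum, re_mul_star_mul_mul_star,
    smul_mul_assoc, map_smul, smul_eq_mul, re_mul_star_comm (φ _) (ψ _)]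
  rw [← Finset.mul_sum, ← Finset.sum_mul, mul_comm, sub_self]

theorem mul_star_outerResidue_add (φ ψ : Fin 2 → K) :
    φ 0 * star (outerResidue φ ψ 1) + outerResidue φ ψ 0 * star (φ 1) = 0 := by
  obtain ⟨n₀, h₀⟩ : ∃ n : ℝ, φ 0 * star (φ 0) = n • (1 : K) := ⟨_, mul_star_self_eq_smul_one _⟩
  obtain ⟨n₁, h₁⟩ : ∃ n : ℝ, φ 1 * star (φ 1) = n • (1 : K) := ⟨_, mul_star_self_eq_smul_one _⟩
  have left := mul_star_mul_add (φ 0 * star (φ 1)) (φ 0) (ψ 0)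
  have right := mul_mul_star_add (φ 0 * star (φ 1)) (φ 1) (ψ 1)
  have cancel_left : star (φ 0) * (φ 0 * star (φ 1)) = n₀ • star (φ 1) := by
    simpa [h₀, re_one] using congrArg star (mul_star_mul_cancel (φ 1) (φ 0))
  have cancel_right : (φ 0 * star (φ 1)) * φ 1 = n₁ • φ 0 := by
    simpa [h₁, re_one] using mul_star_mul_cancel (φ 0) (φ 1)
  rw [cancel_left, mul_smul_comm, ← eq_sub_iff_add_eq'] at left
  rw [cancel_right, smul_mul_assoc, ← eq_sub_iff_add_eq] at right
  simp only [outerResidue, Fin.sum_univ_two, h₀, h₁, smul_mul_assoc, mul_smul_comm, one_mul,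
    star_sub, star_add, star_mul, star_smul, star_star, star_trivial, mul_sub, mul_add, sub_mul,
    add_mul, left, right]
  module

theorem hermOuter_outerResidue (φ ψ : Fin 2 → K) : hermOuter φ (outerResidue φ ψ) = 0 := by
  refine hermEquiv.injective (Prod.ext ?_ (Prod.ext ?_ ?_))
  · simp [hermEquiv, hermOuter, Matrix.vecMulVec_apply, re_outerResidue_mul_star_self,
      re_mul_star_comm (φ 0)]
  · simp [hermEquiv, hermOuter, Matrix.vecMulVec_apply, re_outerResidue_mul_star_self,
      re_mul_star_comm (φ 1)]
  · simpa [hermEquiv, hermOuter, Matrix.vecMulVec_apply] using mul_star_outerResidue_add φ ψ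

theorem re_star_dotProduct_outerResidue_comm (φ ψ : Fin 2 → K) :
    re (star ψ ⬝ᵥ outerResidue φ ψ) = re (star φ ⬝ᵥ outerResidue ψ φ) := by
  have expand (φ ψ : Fin 2 → K) : re (star ψ ⬝ᵥ outerResidue φ ψ) =
      ∑ i, ∑ j, re ((φ i * star (φ j)) * (ψ j * star (ψ i))) -
        (∑ j, re (φ j * star (ψ j))) * ∑ j, re (φ j * star (ψ j)) := by
    simp only [dotProduct, Pi.star_apply, map_sum, re_mul_comm (star _), outerResidue, sub_mul,
      Finset.sum_mul, map_sub, re_mul_assoc _ _ (star _), smul_mul_assoc, map_smul, smul_eq_mul,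
      Finset.sum_sub_distrib, Finset.mul_sum]
  rw [expand, expand, Finset.sum_comm]
  simp only [re_mul_comm (φ _ * _) (ψ _ * _), re_mul_star_comm (φ _) (ψ _)]

theorem cliffordAction_spinorDot_self (Ψ : Spinor K) :
    cliffordAction (spinorDot Ψ Ψ) Ψ = (2 : ℝ) • Sum.elim
      (-outerResidue (Ψ ∘ .inl) (Ψ ∘ .inr)) (outerResidue (Ψ ∘ .inr) (Ψ ∘ .inl)) := by
  have norm (i) : ∃ n : ℝ, Ψ i * star (Ψ i) = n • (1 : K) := ⟨_, mul_star_self_eq_smul_one _⟩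
  choose n hn using norm
  ext i
  rcases i with i | i <;> fin_cases i <;>
  · simp [cliffordAction, Vec.toMatrix, spinorDot, outerResidue, Matrix.mulVec, dotProduct,
      traceReversal, hermOuter, Matrix.vecMulVec_apply, Matrix.trace, re_star_mul, add_mul,
      sub_mul, mul_star_mul_cancel, hn, re_one,
      re_mul_star_comm (Ψ (.inr _)) (Ψ (.inl _))]
    module

theorem spinorDot_outerResidue (φ ψ : Fin 2 → K) :
    spinorDot (Sum.elim ψ φ) (Sum.elim (-outerResidue ψ φ) (outerResidue φ ψ)) = 0 := by
  have herm_neg : hermOuter ψ (-outerResidue ψ φ) = 0 := by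
    rw [← neg_eq_zero, ← hermOuter_outerResidue ψ φ]
    ext i j
    simp [hermOuter, Matrix.vecMulVec_apply, add_comm]
  have re_neg : re (star (-outerResidue ψ φ) ⬝ᵥ φ) = -re (star φ ⬝ᵥ outerResidue ψ φ) := by
    simp [dotProduct, re_star_mul, re_mul_star_comm (φ _)]
  simp only [spinorDot, Sum.elim_comp_inl, Sum.elim_comp_inr, herm_neg, hermOuter_outerResidue,
    re_neg, re_star_dotProduct_outerResidue_comm φ ψ, add_neg_cancel]
  simp [traceReversal]

/-- The four-spinor identity `Ψ · ((Ψ · Ψ) Ψ) = 0`, where alternativity of `K` enters. -/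
theorem spinorDot_cliffordAction_spinorDot_self (Ψ : Spinor K) :
    spinorDot Ψ (cliffordAction (spinorDot Ψ Ψ) Ψ) = 0 := by
  rw [cliffordAction_spinorDot_self, spinorDot_smul_right]
  conv_lhs => enter [2, 1]; rw [← Sum.elim_comp_inl_inr Ψ]
  rw [spinorDot_outerResidue, smul_zero]

theorem spinorPairing_apply (Ψ Φ : Spinor K) :
    spinorPairing Ψ Φ =
      ∑ i, (re (Ψ (.inr i) * star (Φ (.inl i))) - re (Ψ (.inl i) * star (Φ (.inr i)))) := by
  simp [spinorPairing, gammaZero, Matrix.mulVec, dotProduct, Matrix.one_apply, re_star_mul]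
  ring

theorem spinorPairing_swap (Ψ Φ : Spinor K) : spinorPairing Ψ Φ = -spinorPairing Φ Ψ := by
  simp only [spinorPairing_apply, re_mul_star_comm (Φ _)]
  simp

theorem spinorPairing_cliffordAction_comm (v : Vec K) (Ψ Φ : Spinor K) :
    spinorPairing Ψ (cliffordAction v Φ) = spinorPairing Φ (cliffordAction v Ψ) := by
  rw [← metric_spinorDot, ← metric_spinorDot, spinorDot_comm]

/-- `cliffordAction` as a linear map. -/
def cliffordLinear : Vec K →ₗ[ℝ] Module.End ℝ (Spinor K) where
  toFun := cliffordAction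
  map_add' v w := by
    have h : (v + w).toMatrix = v.toMatrix + w.toMatrix := by
      simp only [Vec.toMatrix, Matrix.fromBlocks_add, Prod.fst_add, Prod.snd_add, add_smul,
        Submodule.coe_add, neg_add, traceReversal, Matrix.trace_add, ← Matrix.diagonal_add]
      rw [add_sub_add_comm]
    exact LinearMap.ext fun Ψ => by simp [cliffordAction, h, Matrix.add_mulVec]
  map_smul' r v := by
    have h : (r • v).toMatrix = r • v.toMatrix := by
      simp only [Vec.toMatrix, Matrix.fromBlocks_smul, Prod.smul_fst, Prod.smul_snd, smul_assoc,
        Submodule.coe_smul, smul_neg, traceReversal, Matrix.trace_smul, smul_sub,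
        ← Matrix.diagonal_smul, Pi.smul_def]
    exact LinearMap.ext fun Ψ => by simp [cliffordAction, h, Matrix.smul_mulVec]

/-- `spinorPairing` as a bilinear form. -/
noncomputable def spinorPairingLinear : Spinor K →ₗ[ℝ] Spinor K →ₗ[ℝ] ℝ :=
  LinearMap.mk₂ ℝ spinorPairing
    (fun Ψ Ψ' Φ => by simp [spinorPairing])
    (fun r Ψ Φ => by simp [spinorPairing])
    (fun Ψ Φ Φ' => by simp [spinorPairing, Matrix.mulVec_add])
    (fun r Ψ Φ => by simp [spinorPairing, Matrix.mulVec_smul])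

/-- `⟨Ψ, (v w - w v) Φ⟩` as a multilinear function of `v`, `w`, `Ψ` and `Φ`. -/
noncomputable def membraneForm :
    Vec K →ₗ[ℝ] Vec K →ₗ[ℝ] Spinor K →ₗ[ℝ] Spinor K →ₗ[ℝ] ℝ :=
  LinearMap.mk₂ ℝ (fun v w => spinorPairingLinear.compl₂ ⁅cliffordLinear v, cliffordLinear w⁆)
    (fun v v' w => LinearMap.ext₂ fun Ψ Φ => by simp [Ring.lie_def, mul_add, add_mul]; ring)
    (fun r v w => LinearMap.ext₂ fun Ψ Φ => by simp [Ring.lie_def, mul_sub])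
    (fun v w w' => LinearMap.ext₂ fun Ψ Φ => by simp [Ring.lie_def, mul_add, add_mul]; ring)
    (fun r v w => LinearMap.ext₂ fun Ψ Φ => by simp [Ring.lie_def, mul_sub])

theorem membraneForm_apply (v w : Vec K) (Ψ Φ : Spinor K) :
    membraneForm v w Ψ Φ = spinorPairing Ψ (⁅cliffordAction v, cliffordAction w⁆ Φ) := rfl

theorem membraneForm_eq_sub (v w : Vec K) (Ψ Φ : Spinor K) :
    membraneForm v w Ψ Φ = spinorPairing Ψ (cliffordAction v (cliffordAction w Φ)) -
      spinorPairing Ψ (cliffordAction w (cliffordAction v Φ)) :=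
  map_sub (spinorPairingLinear Ψ) _ _

theorem membraneForm_swap (v w : Vec K) (Ψ Φ : Spinor K) :
    membraneForm v w Ψ Φ = -membraneForm w v Ψ Φ := by
  rw [membraneForm_eq_sub, membraneForm_eq_sub, neg_sub]

theorem membraneForm_comm (v w : Vec K) (Ψ Φ : Spinor K) :
    membraneForm v w Ψ Φ = membraneForm v w Φ Ψ := by
  have transpose (v w : Vec K) (Ψ Φ : Spinor K) :
      spinorPairing Ψ (cliffordAction v (cliffordAction w Φ)) =
        -spinorPairing Φ (cliffordAction w (cliffordAction v Ψ)) := by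
    rw [spinorPairing_cliffordAction_comm, spinorPairing_swap, spinorPairing_cliffordAction_comm]
  rw [membraneForm_eq_sub, membraneForm_eq_sub, transpose v w Ψ Φ, transpose w v Ψ Φ]
  ring

theorem membraneForm_spinorDot_self (v : Vec K) (Ψ : Spinor K) :
    membraneForm (spinorDot Ψ Ψ) v Ψ Ψ = 0 := by
  have orthogonal (v : Vec K) :
      spinorPairing Ψ (cliffordAction v (cliffordAction (spinorDot Ψ Ψ) Ψ)) = 0 := by
    rw [← metric_spinorDot, spinorDot_cliffordAction_spinorDot_self]
    simpa using metric_smul_left 0 (0 : Vec K) v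
  have orthogonal' : spinorPairing Ψ (cliffordAction (spinorDot Ψ Ψ) (cliffordAction v Ψ)) = 0 := by
    rw [spinorPairing_cliffordAction_comm, spinorPairing_swap, spinorPairing_cliffordAction_comm,
      orthogonal, neg_zero]
  rw [membraneForm_eq_sub, orthogonal, orthogonal', sub_zero]

end Spacetime

section Polarization

variable {E : Type*} [AddCommGroup E] [Module ℝ E] (f : E →ₗ[ℝ] E →ₗ[ℝ] E →ₗ[ℝ] E →ₗ[ℝ] ℝ)

theorem cubic_polarization_of_diagonal
    (swap₁₂ : ∀ a b c d, f a b c d = f b a c d) (swap₃₄ : ∀ a b c d, f a b c d = f a b d c)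
    (diag : ∀ a, f a a a a = 0) (a b : E) : f a a a b + f a b a a = 0 := by
  have at_add := diag (a + b)
  have at_sub := diag (a + (-1 : ℝ) • b)
  have at_two := diag (a + (2 : ℝ) • b)
  simp only [map_add, map_smul, LinearMap.add_apply, LinearMap.smul_apply, smul_eq_mul,
    diag] at at_add at_sub at_two
  linarith [swap₁₂ a b a a, swap₃₄ a a a b, swap₁₂ a b a b, swap₁₂ a b b a, swap₃₄ b a a b,
    swap₁₂ a b b b, swap₃₄ b b a b]

theorem quadratic_polarization_of_diagonal
    (swap₁₂ : ∀ a b c d, f a b c d = f b a c d) (swap₃₄ : ∀ a b c d, f a b c d = f a b d c)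
    (diag : ∀ a, f a a a a = 0) (a b c : E) :
    2 * f a c a b + f a a c b + f c b a a + 2 * f a b a c = 0 := by
  have cubic := cubic_polarization_of_diagonal f swap₁₂ swap₃₄ diag
  have at_add := cubic (a + c) b
  have at_sub := cubic (a + (-1 : ℝ) • c) b
  simp only [map_add, map_smul, LinearMap.add_apply, LinearMap.smul_apply,
    smul_eq_mul] at at_add at_sub
  linarith [cubic a b, cubic c b, swap₁₂ a c a b, swap₁₂ a c c b, swap₃₄ a b a c, swap₃₄ c b a c]

theorem sum_pairs_eq_zero_of_diagonal
    (swap₁₂ : ∀ a b c d, f a b c d = f b a c d) (swap₃₄ : ∀ a b c d, f a b c d = f a b d c)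
    (diag : ∀ a, f a a a a = 0) (a b c d : E) :
    f a b c d + f a c b d + f a d b c + f b c a d + f b d a c + f c d a b = 0 := by
  have quadratic := quadratic_polarization_of_diagonal f swap₁₂ swap₃₄ diag
  have at_add := quadratic (a + b) d c
  simp only [map_add, LinearMap.add_apply] at at_add
  linarith [quadratic a d c, quadratic b d c, swap₁₂ a b c d, swap₃₄ c d a b, swap₃₄ a d b c,
    swap₃₄ b d a c]

end Polarization

section FourSpinorIdentity

variable {K : Type*} [NonAssocRing K] [StarRing K] [Module ℝ K] [IsScalarTower ℝ K K]
  [SMulCommClass ℝ K K] [StarModule ℝ K] [NormedDivisionAlgebra K]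

/-- `spinorDot` as a bilinear map. -/
noncomputable def spinorDotLinear : Spinor K →ₗ[ℝ] Spinor K →ₗ[ℝ] Vec K :=
  LinearMap.mk₂ ℝ spinorDot
    (fun Ψ Ψ' Φ => by simp only [spinorDot_comm _ Φ, spinorDot_add_right])
    (fun r Ψ Φ => by simp only [spinorDot_comm _ Φ, spinorDot_smul_right])
    spinorDot_add_right spinorDot_smul_right

theorem membraneForm_spinorDot_sum (v : Vec K) (Ψ₁ Ψ₂ Ψ₃ Ψ₄ : Spinor K) :
    membraneForm (spinorDot Ψ₁ Ψ₂) v Ψ₃ Ψ₄ + membraneForm (spinorDot Ψ₁ Ψ₃) v Ψ₂ Ψ₄ +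
      membraneForm (spinorDot Ψ₁ Ψ₄) v Ψ₂ Ψ₃ + membraneForm (spinorDot Ψ₂ Ψ₃) v Ψ₁ Ψ₄ +
      membraneForm (spinorDot Ψ₂ Ψ₄) v Ψ₁ Ψ₃ + membraneForm (spinorDot Ψ₃ Ψ₄) v Ψ₁ Ψ₂ = 0 :=
  sum_pairs_eq_zero_of_diagonal (spinorDotLinear.compr₂ (membraneForm.flip v))
    (fun a b c d => congrArg (fun u => membraneForm u v c d) (spinorDot_comm a b))
    (fun a b c d => membraneForm_comm (spinorDot a b) v c d)
    (membraneForm_spinorDot_self v) Ψ₁ Ψ₂ Ψ₃ Ψ₄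

end FourSpinorIdentity

section KoszulSigns

theorem zmod_two_eq_zero_or_one (p : ZMod 2) : p = 0 ∨ p = 1 := by
  revert p
  decide

theorem paritySign_zero : paritySign 0 = 1 := rfl

theorem paritySign_one : paritySign 1 = -1 := rfl

theorem paritySign_mul_self (p : ZMod 2) : paritySign p * paritySign p = 1 := by
  rcases zmod_two_eq_zero_or_one p with rfl | rfl <;> simp [paritySign_zero, paritySign_one]

theorem paritySign_add (p q : ZMod 2) : paritySign (p + q) = paritySign p * paritySign q := by
  rcases zmod_two_eq_zero_or_one p with rfl | rfl <;>
    rcases zmod_two_eq_zero_or_one q with rfl | rfl <;>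
    simp [paritySign, (by decide : (1 + 1 : ZMod 2) = 0)]

theorem prod_Ioi_comp_perm {n : ℕ} (τ : Equiv.Perm (Fin n)) (f : Fin n → Fin n → ℝ)
    (symm : ∀ a b, f a b = f b a) :
    ∏ a, ∏ b ∈ Finset.Ioi a, f (τ a) (τ b) = ∏ a, ∏ b ∈ Finset.Ioi a, f a b := by
  let s (a b : Fin n) : ℝ := if a < b then 1 else if b < a then -1 else 0
  have s_antisymm (a b : Fin n) : s a b = -s b a := by
    rcases lt_trichotomy a b with h | rfl | h <;> simp [s, *, not_lt_of_gt]
  have s_prod : ∏ a, ∏ b ∈ Finset.Ioi a, s a b = 1 :=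
    Finset.prod_eq_one fun a _ => Finset.prod_eq_one fun b hb => if_pos (Finset.mem_Ioi.1 hb)
  have hs := τ.prod_Ioi_comp_eq_sign_mul_prod s_antisymm
  have hsf := τ.prod_Ioi_comp_eq_sign_mul_prod (f := fun a b => s a b * f a b)
    fun a b => by rw [s_antisymm a b, symm a b, neg_mul]
  simp only [Finset.prod_mul_distrib, s_prod, hs, mul_one, one_mul] at hsf
  exact mul_left_cancel₀ (by simp) hsf

theorem koszulSign_eq_prod_Ioi {n : ℕ} (σ : Equiv.Perm (Fin n)) (d : Fin n → ZMod 2) :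
    koszulSign σ d = ∏ a, ∏ b ∈ Finset.Ioi a,
      if σ b < σ a then paritySign (d (σ a) * d (σ b)) else 1 := by
  refine Finset.prod_congr rfl fun a _ => ?_
  rw [← Finset.filter_lt_eq_Ioi, Finset.prod_filter]
  exact Finset.prod_congr rfl fun b _ => ite_and ..

theorem koszulSign_mul {n : ℕ} (σ τ : Equiv.Perm (Fin n)) (d : Fin n → ZMod 2) :
    koszulSign (σ * τ) d = koszulSign σ d * koszulSign τ (d ∘ σ) := by
  let inversion (a b : Fin n) : ℝ :=
    if a < b ↔ σ b < σ a then paritySign (d (σ a) * d (σ b)) else 1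
  have inversion_symm (a b : Fin n) : inversion a b = inversion b a := by
    have hσ : a ≠ b → σ a ≠ σ b := σ.injective.ne
    have : (a < b ↔ σ b < σ a) ↔ (b < a ↔ σ a < σ b) := by grind
    simp only [inversion, this, mul_comm (d (σ a))]
  have hσ : koszulSign σ d = ∏ a, ∏ b ∈ Finset.Ioi a, inversion (τ a) (τ b) := by
    rw [prod_Ioi_comp_perm τ inversion inversion_symm, koszulSign_eq_prod_Ioi]
    refine Finset.prod_congr rfl fun a _ => Finset.prod_congr rfl fun b hb => ?_
    simp only [inversion, Finset.mem_Ioi.1 hb, true_iff]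
  simp only [hσ, koszulSign_eq_prod_Ioi, ← Finset.prod_mul_distrib]
  refine Finset.prod_congr rfl fun a _ => Finset.prod_congr rfl fun b hb => ?_
  have hτ : τ a < τ b ↔ ¬ τ b < τ a :=
    (lt_iff_le_and_ne.trans (and_iff_left (τ.injective.ne (Finset.mem_Ioi.1 hb).ne))).trans
      not_lt.symm
  by_cases h₁ : σ (τ b) < σ (τ a) <;> by_cases h₂ : τ b < τ a <;>
    simp [inversion, hτ, h₁, h₂, paritySign_mul_self]

theorem chi_mul {n : ℕ} (σ τ : Equiv.Perm (Fin n)) (d : Fin n → ZMod 2) :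
    chi (σ * τ) d = chi σ d * chi τ (d ∘ σ) := by
  simp only [chi, koszulSign_mul, Equiv.Perm.sign_mul, Units.val_mul, Int.cast_mul]
  ring

theorem chi_one {n : ℕ} (d : Fin n → ZMod 2) : chi 1 d = 1 := by
  have h : koszulSign 1 d = 1 :=
    Finset.prod_eq_one fun a _ => Finset.prod_eq_one fun b _ => if_neg fun h => h.1.not_gt h.2
  simp [chi, h]

theorem chi_ne_zero {n : ℕ} (σ : Equiv.Perm (Fin n)) (d : Fin n → ZMod 2) : chi σ d ≠ 0 := by
  have h := chi_mul σ σ⁻¹ d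
  rw [mul_inv_cancel, chi_one] at h
  exact left_ne_zero_of_mul (h.symm ▸ one_ne_zero)

theorem koszulSign_swap_castSucc_succ {n : ℕ} (i : Fin n) (d : Fin (n + 1) → ZMod 2) :
    koszulSign (Equiv.swap i.castSucc i.succ) d = paritySign (d i.castSucc * d i.succ) := by
  have inversion_iff (a b : Fin (n + 1)) :
      a < b ∧ Equiv.swap i.castSucc i.succ b < Equiv.swap i.castSucc i.succ a ↔
        a = i.castSucc ∧ b = i.succ := by
    simp only [Equiv.swap_apply_def, Fin.lt_def, Fin.ext_iff]
    split_ifs <;> simp_all <;> omega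
  simp only [koszulSign, inversion_iff, ite_and, Finset.prod_ite_irrel, Finset.prod_const_one]
  simp [mul_comm]

theorem chi_swap_castSucc_succ {n : ℕ} (i : Fin n) (d : Fin (n + 1) → ZMod 2) :
    chi (Equiv.swap i.castSucc i.succ) d = -paritySign (d i.castSucc * d i.succ) := by
  rw [chi, koszulSign_swap_castSucc_succ,
    Equiv.Perm.sign_swap (Fin.castSucc_lt_succ (i := i)).ne]
  simp

end KoszulSigns

section Homogeneous

variable {g R : Type*} [AddCommGroup g] [Module ℝ g] [SuperSpace g]
  [AddCommGroup R] [Module ℝ R]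

theorem skew_of_adjacent {n : ℕ} (ω : MultilinearMap ℝ (fun _ : Fin (n + 1) => g) R)
    (adjacent : ∀ (i : Fin n) (x : Fin (n + 1) → g) (p : Fin (n + 1) → ZMod 2),
      (∀ i, x i ∈ SuperSpace.part g (p i)) →
      ω (fun j => x (Equiv.swap i.castSucc i.succ j)) =
        -(paritySign (p i.castSucc * p i.succ) • ω x))
    (σ : Equiv.Perm (Fin (n + 1))) (x : Fin (n + 1) → g) (p : Fin (n + 1) → ZMod 2)
    (hx : ∀ i, x i ∈ SuperSpace.part g (p i)) :
    ω (fun i => x (σ i)) = chi σ p • ω x := by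
  have hσ : σ ∈ Submonoid.closure
      (Set.range fun i : Fin n => Equiv.swap i.castSucc i.succ) := by
    rw [Equiv.Perm.mclosure_swap_castSucc_succ]
    trivial
  induction hσ using Submonoid.closure_induction generalizing x p with
  | mem σ hσ =>
    obtain ⟨i, rfl⟩ := hσ
    rw [chi_swap_castSucc_succ, neg_smul]
    exact adjacent i x p hx
  | one => simp [chi_one]
  | mul σ τ _ _ ihσ ihτ =>
    rw [chi_mul, mul_comm, mul_smul, ← ihσ x p hx]
    exact ihτ (fun i => x (σ i)) (p ∘ σ) fun i => hx _

theorem exists_even_add_odd (x : g) :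
    ∃ y ∈ SuperSpace.part g 0, ∃ z ∈ SuperSpace.part g 1, y + z = x := by
  rw [← Submodule.mem_sup]
  simp [SuperSpace.part, (SuperSpace.isCompl (W := g)).sup_eq_top]

theorem multilinearMap_ext_of_homogeneous {n : ℕ}
    {ω ω' : MultilinearMap ℝ (fun _ : Fin n => g) R}
    (h : ∀ (x : Fin n → g) (p : Fin n → ZMod 2), (∀ i, x i ∈ SuperSpace.part g (p i)) →
      ω x = ω' x) : ω = ω' := by
  ext x
  choose y hy z hz hyz using fun i => exists_even_add_odd (x i)
  obtain rfl : y + z = x := funext hyz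
  rw [MultilinearMap.map_add_univ, MultilinearMap.map_add_univ]
  refine Finset.sum_congr rfl fun s _ => h _ (fun i => if i ∈ s then 0 else 1) fun i => ?_
  by_cases hi : i ∈ s
  · simpa [hi] using hy i
  · simpa [hi] using hz i

end Homogeneous

section Unshuffles

variable {n : ℕ}

/-- The permutation `0 ↦ j`, `k + 1 ↦ j.succAbove (τ k)`. Every permutation has this form, which
reduces the signs of unshuffles to those of their first values. -/
def insertFirst (j : Fin (n + 1)) (τ : Equiv.Perm (Fin n)) : Equiv.Perm (Fin (n + 1)) :=
  j.cycleRange.symm * Equiv.Perm.decomposeFin.symm (0, τ)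

theorem insertFirst_zero (j : Fin (n + 1)) (τ : Equiv.Perm (Fin n)) : insertFirst j τ 0 = j := by
  simp [insertFirst]

theorem insertFirst_succ (j : Fin (n + 1)) (τ : Equiv.Perm (Fin n)) (k : Fin n) :
    insertFirst j τ k.succ = j.succAbove (τ k) := by
  simp [insertFirst]

theorem exists_eq_insertFirst (σ : Equiv.Perm (Fin (n + 1))) :
    ∃ τ, σ = insertFirst (σ 0) τ := by
  obtain ⟨⟨j, τ⟩, h⟩ := Equiv.Perm.decomposeFin.symm.surjective ((σ 0).cycleRange * σ)
  have hj : j = 0 := by simpa using congrArg (· 0) h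
  subst hj
  exact ⟨τ, by rw [insertFirst, h, ← Equiv.Perm.inv_def, inv_mul_cancel_left]⟩

theorem paritySign_mul_sum {ι : Type*} (s : Finset ι) (c : ZMod 2) (d : ι → ZMod 2) :
    paritySign (c * ∑ a ∈ s, d a) = ∏ a ∈ s, paritySign (c * d a) := by
  classical
  induction s using Finset.induction_on with
  | empty => simp [paritySign_zero]
  | insert a s ha ih =>
    rw [Finset.sum_insert ha, Finset.prod_insert ha, mul_add, paritySign_add, ih]

theorem koszulSign_insertFirst (j : Fin (n + 1)) (τ : Equiv.Perm (Fin n))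
    (d : Fin (n + 1) → ZMod 2) :
    koszulSign (insertFirst j τ) d =
      paritySign (d j * ∑ a with a < j, d a) * koszulSign τ (d ∘ j.succAbove) := by
  have first : ∏ b, (if j.succAbove (τ b) < j then paritySign (d j * d (j.succAbove (τ b))) else 1)
      = paritySign (d j * ∑ a with a < j, d a) := by
    rw [Equiv.prod_comp τ fun b =>
      if j.succAbove b < j then paritySign (d j * d (j.succAbove b)) else 1,
      paritySign_mul_sum, Finset.prod_filter, Fin.prod_univ_succAbove _ j]
    simp
  rw [koszulSign, Fin.prod_univ_succ, ← first]
  simp [koszulSign, Fin.prod_univ_succ, insertFirst_zero, insertFirst_succ,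
    (Fin.strictMono_succAbove j).lt_iff_lt]

theorem chi_insertFirst (j : Fin (n + 1)) (τ : Equiv.Perm (Fin n)) (d : Fin (n + 1) → ZMod 2) :
    chi (insertFirst j τ) d =
      (-1) ^ (j : ℕ) * paritySign (d j * ∑ a with a < j, d a) * chi τ (d ∘ j.succAbove) := by
  have sign : Equiv.Perm.sign (insertFirst j τ) = (-1) ^ (j : ℕ) * Equiv.Perm.sign τ := by
    simp [insertFirst]
  rw [chi, sign, koszulSign_insertFirst, chi]
  push_cast
  ring

/-- The permutation with values `i`, `k + 1` at `0`, `1` that is increasing on the other arguments,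
for `i ≤ k`. -/
def unshuffle (i k : Fin (n + 1)) : Equiv.Perm (Fin (n + 2)) :=
  insertFirst i.castSucc (insertFirst k 1)

theorem unshuffle_zero (i k : Fin (n + 1)) : unshuffle i k 0 = i.castSucc :=
  insertFirst_zero ..

theorem unshuffle_one {i k : Fin (n + 1)} (hik : i ≤ k) : unshuffle i k 1 = k.succ := by
  rw [unshuffle, ← Fin.succ_zero_eq_one, insertFirst_succ, insertFirst_zero,
    Fin.succAbove_of_le_castSucc _ _ (Fin.castSucc_le_castSucc_iff.2 hik)]

theorem unshuffle_succ_succ {i k : Fin (n + 1)} (hik : i ≤ k) (t : Fin n) :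
    unshuffle i k t.succ.succ = k.succ.succAbove (i.succAbove t) := by
  rw [unshuffle, insertFirst_succ, insertFirst_succ, Equiv.Perm.one_apply]
  simp only [Fin.succAbove, Fin.lt_def, Fin.ext_iff, apply_ite Fin.val, Fin.val_castSucc,
    Fin.val_succ]
  grind

theorem sum_lt_succ_eq_add {i k : Fin (n + 1)} (hik : i ≤ k) (d : Fin (n + 2) → ZMod 2) :
    ∑ a with a < k.succ, d a = d i.castSucc + ∑ a with a < k, d (i.castSucc.succAbove a) := by
  have succAbove_lt (a : Fin (n + 1)) : i.castSucc.succAbove a < k.succ ↔ a < k := by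
    simp only [Fin.succAbove, Fin.lt_def, apply_ite Fin.val, Fin.val_castSucc, Fin.val_succ]
    grind
  rw [Finset.sum_filter, Fin.sum_univ_succAbove _ i.castSucc,
    if_pos (Fin.castSucc_lt_succ_iff.2 hik), Finset.sum_filter]
  simp only [succAbove_lt]

theorem chi_unshuffle {i k : Fin (n + 1)} (hik : i ≤ k) (d : Fin (n + 2) → ZMod 2) :
    chi (unshuffle i k) d = -((-1 : ℝ) ^ ((i : ℕ) + (k.succ : ℕ)) *
      paritySign (d i.castSucc * d k.succ) *
      paritySign (d i.castSucc * ∑ a with a < i.castSucc, d a) *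
      paritySign (d k.succ * ∑ a with a < k.succ, d a)) := by
  rw [unshuffle, chi_insertFirst, chi_insertFirst, chi_one, sum_lt_succ_eq_add hik, mul_add,
    paritySign_add, mul_comm (d i.castSucc) (d k.succ)]
  simp only [Function.comp_apply, Fin.succAbove_of_le_castSucc _ _
    (Fin.castSucc_le_castSucc_iff.2 hik)]
  have hsq := paritySign_mul_self (d k.succ * d i.castSucc)
  simp only [Fin.val_castSucc, Fin.val_succ, pow_add, pow_one]
  linear_combination (-(1 : ℝ)) ^ (i : ℕ) * (-1) ^ (k : ℕ) *
    paritySign (d i.castSucc * ∑ a with a < i.castSucc, d a) *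
    paritySign (d k.succ * ∑ a with a < k, d (i.castSucc.succAbove a)) * (-hsq)

/-- `σ` is increasing on the first `r` arguments and on the others. -/
abbrev IsUnshuffle (r : ℕ) (σ : Equiv.Perm (Fin n)) : Prop :=
  (∀ a b : Fin n, a < b → (b : ℕ) < r → σ a < σ b) ∧
    ∀ a b : Fin n, a < b → r ≤ (a : ℕ) → σ a < σ b

theorem isUnshuffle_unshuffle {i k : Fin (n + 1)} (hik : i ≤ k) :
    IsUnshuffle 2 (unshuffle i k) := by
  constructor
  · intro a b hab hb
    obtain rfl : a = 0 := Fin.ext (show (a : ℕ) = 0 by omega)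
    obtain rfl : b = 1 := Fin.ext (show (b : ℕ) = 1 by omega)
    rw [unshuffle_zero, unshuffle_one hik]
    exact Fin.castSucc_lt_succ_iff.2 hik
  · intro a b hab ha
    obtain ⟨s, rfl⟩ : ∃ s : Fin n, a = s.succ.succ := ⟨⟨a - 2, by omega⟩, by ext; simp; omega⟩
    obtain ⟨t, rfl⟩ : ∃ t : Fin n, b = t.succ.succ := ⟨⟨b - 2, by omega⟩, by ext; simp; omega⟩
    rw [unshuffle_succ_succ hik, unshuffle_succ_succ hik]
    exact Fin.strictMono_succAbove _ (Fin.strictMono_succAbove _ (by simpa using hab))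

theorem IsUnshuffle.exists_eq_unshuffle {σ : Equiv.Perm (Fin (n + 2))} (h : IsUnshuffle 2 σ) :
    ∃ i k : Fin (n + 1), i ≤ k ∧ σ = unshuffle i k := by
  obtain ⟨τ, hσ⟩ := exists_eq_insertFirst σ
  obtain ⟨υ, hτ⟩ := exists_eq_insertFirst τ
  have h_one : σ 1 = (σ 0).succAbove (τ 0) := by
    rw [hσ, ← Fin.succ_zero_eq_one, insertFirst_succ, insertFirst_zero]
  have h_le : σ 0 ≤ (τ 0).castSucc := by
    rw [← Fin.lt_succAbove_iff_le_castSucc, ← h_one]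
    exact h.1 0 1 (by simp) (by simp)
  have h_tail (t : Fin n) : σ t.succ.succ = (σ 0).succAbove ((τ 0).succAbove (υ t)) := by
    conv_lhs => rw [hσ, insertFirst_succ, hτ, insertFirst_succ]
  have υ_eq_one : υ = 1 := by
    have υ_mono : StrictMono υ := fun s t hst => by
      have := h.2 s.succ.succ t.succ.succ (by simpa using hst) (by simp)
      rwa [h_tail, h_tail, (Fin.strictMono_succAbove _).lt_iff_lt,
        (Fin.strictMono_succAbove _).lt_iff_lt] at this
    exact Equiv.ext fun t => congrFun υ_mono.eq_id t
  obtain ⟨i, hi⟩ := Fin.exists_castSucc_eq.2 (h_le.trans_lt (Fin.castSucc_lt_last _)).ne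
  rw [← hi, Fin.castSucc_le_castSucc_iff] at h_le
  exact ⟨i, τ 0, h_le, by rw [unshuffle, hi, ← υ_eq_one, ← hτ, ← hσ]⟩

theorem sum_isUnshuffle {M : Type*} [AddCommMonoid M]
    [DecidablePred (IsUnshuffle 2 : Equiv.Perm (Fin (n + 2)) → Prop)]
    (f : Equiv.Perm (Fin (n + 2)) → M) :
    ∑ σ with IsUnshuffle 2 σ, f σ = ∑ i, ∑ k, if i ≤ k then f (unshuffle i k) else 0 := by
  rw [← Fintype.sum_prod_type', ← Finset.sum_filter]
  symm
  refine Finset.sum_nbij (fun x => unshuffle x.1 x.2) ?_ ?_ ?_ fun _ _ => rfl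
  · exact fun x hx => Finset.mem_filter.2
      ⟨Finset.mem_univ _, isUnshuffle_unshuffle (Finset.mem_filter.1 hx).2⟩
  · intro x hx y hy hxy
    have h₀ := congrArg (· 0) hxy
    have h₁ := congrArg (· 1) hxy
    simp only [unshuffle_zero, unshuffle_one (Finset.mem_filter.1 hx).2,
      unshuffle_one (Finset.mem_filter.1 hy).2] at h₀ h₁
    exact Prod.ext (Fin.castSucc_injective _ h₀) (Fin.succ_injective _ h₁)
  · intro σ hσ
    obtain ⟨i, k, hik, rfl⟩ := (Finset.mem_filter.1 hσ).2.exists_eq_unshuffle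
    exact ⟨(i, k), by simpa using hik, rfl⟩

variable {g R : Type*} [AddCommGroup g] [Module ℝ g] [AddCommGroup R] [Module ℝ R]

/-- The sum over unshuffles in the `L∞` Jacobi identity is, up to sign, the Chevalley-Eilenberg
differential. -/
theorem sum_isUnshuffle_eq_neg_coboundary
    [DecidablePred (IsUnshuffle 2 : Equiv.Perm (Fin (n + 2)) → Prop)] (br : g → g → g)
    (ω : MultilinearMap ℝ (fun _ : Fin (n + 1) => g) R) (s : ZMod 2) (x : Fin (n + 2) → g)
    (p : Fin (n + 2) → ZMod 2) :
    ∑ σ with IsUnshuffle 2 σ,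
      chi σ p • ω (Fin.cons (br (x (σ 0)) (x (σ 1))) fun t => x (σ t.succ.succ)) =
      -coboundary br (fun _ _ => 0) ω s x p := by
  simp only [coboundary, smul_zero, Finset.sum_const_zero, zero_add, Fin.sum_univ_succ (n := n + 1),
    Fin.not_lt_zero, if_false, Fin.castSucc_lt_succ_iff, sum_isUnshuffle, ← Finset.sum_neg_distrib]
  refine Finset.sum_congr rfl fun i _ => Finset.sum_congr rfl fun k _ => ?_
  split_ifs with hik
  · simp only [chi_unshuffle hik, unshuffle_zero, unshuffle_one hik, unshuffle_succ_succ hik,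
      neg_smul]
  · rw [neg_zero]

end Unshuffles

section MembraneCochain

variable {K : Type*} [NonAssocRing K] [StarRing K] [Module ℝ K] [IsScalarTower ℝ K K]
  [SMulCommClass ℝ K K] [StarModule ℝ K] [NormedDivisionAlgebra K]

/-- The `(2, 2)`-form `β`: one summand for each way of choosing the two spinors among the arguments,
with the sign of the unshuffle that moves them to the front. -/
noncomputable def membraneCochain : MultilinearMap ℝ (fun _ : Fin 4 => Supertranslation K) ℝ :=
  MultilinearMap.mk' (fun x =>
    membraneForm (x 2).1 (x 3).1 (x 0).2 (x 1).2 - membraneForm (x 1).1 (x 3).1 (x 0).2 (x 2).2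
      + membraneForm (x 1).1 (x 2).1 (x 0).2 (x 3).2
      + membraneForm (x 0).1 (x 3).1 (x 1).2 (x 2).2
      - membraneForm (x 0).1 (x 2).1 (x 1).2 (x 3).2
      + membraneForm (x 0).1 (x 1).1 (x 2).2 (x 3).2)
    (fun x i y z => by fin_cases i <;> simp <;> ring)
    (fun x i r y => by fin_cases i <;> simp <;> ring)

theorem membraneCochain_apply (x : Fin 4 → Supertranslation K) : membraneCochain x =
    membraneForm (x 2).1 (x 3).1 (x 0).2 (x 1).2 - membraneForm (x 1).1 (x 3).1 (x 0).2 (x 2).2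
      + membraneForm (x 1).1 (x 2).1 (x 0).2 (x 3).2
      + membraneForm (x 0).1 (x 3).1 (x 1).2 (x 2).2
      - membraneForm (x 0).1 (x 2).1 (x 1).2 (x 3).2
      + membraneForm (x 0).1 (x 1).1 (x 2).2 (x 3).2 := rfl

theorem Supertranslation.part_cases {x : Supertranslation K} {p : ZMod 2}
    (hx : x ∈ SuperSpace.part (Supertranslation K) p) :
    p = 0 ∧ x.2 = 0 ∨ p = 1 ∧ x.1 = 0 := by
  rcases zmod_two_eq_zero_or_one p with rfl | rfl
  · exact Or.inl ⟨rfl, mem_part_zero.1 hx⟩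
  · exact Or.inr ⟨rfl, mem_part_one.1 hx⟩

theorem membraneCochain_eq_zero (x : Fin 4 → Supertranslation K) (p : Fin 4 → ZMod 2)
    (hx : ∀ i, x i ∈ SuperSpace.part (Supertranslation K) (p i))
    (hp : Finset.card {i | p i = 1} ≠ 2) : membraneCochain x = 0 := by
  rw [Finset.card_filter, Fin.sum_univ_four] at hp
  rw [membraneCochain_apply]
  rcases Supertranslation.part_cases (hx 0) with ⟨e₀, h₀⟩ | ⟨e₀, h₀⟩ <;>
  rcases Supertranslation.part_cases (hx 1) with ⟨e₁, h₁⟩ | ⟨e₁, h₁⟩ <;>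
  rcases Supertranslation.part_cases (hx 2) with ⟨e₂, h₂⟩ | ⟨e₂, h₂⟩ <;>
  rcases Supertranslation.part_cases (hx 3) with ⟨e₃, h₃⟩ | ⟨e₃, h₃⟩ <;>
  first
  | (simp only [h₀, h₁, h₂, h₃, map_zero, LinearMap.zero_apply, sub_zero, add_zero]; done)
  | exact absurd (by simp [e₀, e₁, e₂, e₃]) hp

theorem membraneCochain_adjacent (i : Fin 3) (x : Fin 4 → Supertranslation K)
    (p : Fin 4 → ZMod 2) (hx : ∀ i, x i ∈ SuperSpace.part (Supertranslation K) (p i)) :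
    membraneCochain (fun j => x (Equiv.swap i.castSucc i.succ j)) =
      -(paritySign (p i.castSucc * p i.succ) • membraneCochain x) := by
  rw [membraneCochain_apply, membraneCochain_apply]
  rcases Supertranslation.part_cases (hx i.castSucc) with ⟨e, h⟩ | ⟨e, h⟩ <;>
  rcases Supertranslation.part_cases (hx i.succ) with ⟨e', h'⟩ | ⟨e', h'⟩ <;>
  fin_cases i <;>
  simp [Equiv.swap_apply_def] at e e' h h' ⊢ <;>
  simp [e, e', h, h', paritySign_zero, paritySign_one,
    membraneForm_comm _ _ (x 1).2 (x 0).2, membraneForm_comm _ _ (x 2).2 (x 1).2,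
    membraneForm_comm _ _ (x 3).2 (x 2).2, membraneForm_swap (x 1).1 (x 0).1,
    membraneForm_swap (x 2).1 (x 1).1, membraneForm_swap (x 3).1 (x 2).1] <;>
  ring

theorem isMembraneForm_membraneCochain : IsMembraneForm (membraneCochain (K := K)) where
  isCochain :=
    { skew := skew_of_adjacent _ membraneCochain_adjacent
      parity := fun x p hx => by
        rw [zero_add]
        by_cases hp : Finset.card {i | p i = 1} = 2
        · have sum_eq_zero : ∀ p : Fin 4 → ZMod 2,
              Finset.card {i | p i = 1} = 2 → ∑ i, p i = 0 := by
            decide +kernel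
          rw [sum_eq_zero p hp]
          exact Submodule.mem_top
        · rw [membraneCochain_eq_zero x p hx hp]
          exact Submodule.zero_mem _ }
  eq_zero := membraneCochain_eq_zero
  apply Ψ Φ v w := by
    simp [membraneCochain_apply, membraneForm_apply]

theorem IsMembraneForm.unique {β β' : MultilinearMap ℝ (fun _ : Fin 4 => Supertranslation K) ℝ}
    (h : IsMembraneForm β) (h' : IsMembraneForm β') : β = β' := by
  refine multilinearMap_ext_of_homogeneous fun x p hx => ?_
  by_cases hp : Finset.card {i | p i = 1} = 2
  · obtain ⟨σ, h₀, h₁, h₂, h₃⟩ : ∃ σ : Equiv.Perm (Fin 4),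
        p (σ 0) = 1 ∧ p (σ 1) = 1 ∧ p (σ 2) = 0 ∧ p (σ 3) = 0 := by
      clear hx
      revert p
      decide +kernel
    have spinors_first : (fun i => x (σ i)) =
        ![(0, (x (σ 0)).2), (0, (x (σ 1)).2), ((x (σ 2)).1, 0), ((x (σ 3)).1, 0)] := by
      funext i
      have hxi := hx (σ i)
      fin_cases i
      · exact Prod.ext (mem_part_one.1 (h₀ ▸ hxi)) rfl
      · exact Prod.ext (mem_part_one.1 (h₁ ▸ hxi)) rfl
      · exact Prod.ext rfl (mem_part_zero.1 (h₂ ▸ hxi))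
      · exact Prod.ext rfl (mem_part_zero.1 (h₃ ▸ hxi))
    refine smul_right_injective ℝ (chi_ne_zero σ p) ?_
    change chi σ p • β x = chi σ p • β' x
    rw [← h.isCochain.skew σ x p hx, ← h'.isCochain.skew σ x p hx, spinors_first, h.apply,
      h'.apply]
  · rw [h.eq_zero x p hx hp, h'.eq_zero x p hx hp]

theorem membraneCochain_cons_vec (v : Vec K) (x : Fin 3 → Supertranslation K) :
    membraneCochain (Fin.cons (v, 0) x : Fin 4 → Supertranslation K) =
      membraneForm v (x 2).1 (x 0).2 (x 1).2 - membraneForm v (x 1).1 (x 0).2 (x 2).2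
        + membraneForm v (x 0).1 (x 1).2 (x 2).2 := by
  have h₁ : (Fin.cons (v, 0) x : Fin 4 → Supertranslation K) 1 = x 0 := rfl
  have h₂ : (Fin.cons (v, 0) x : Fin 4 → Supertranslation K) 2 = x 1 := rfl
  have h₃ : (Fin.cons (v, 0) x : Fin 4 → Supertranslation K) 3 = x 2 := rfl
  simp [membraneCochain_apply, h₁, h₂, h₃]

/-- Each nonzero term of the coboundary brackets two spinors and leaves one vector and two
spinors. -/
theorem coboundary_membraneCochain_of_card_ne (x : Fin 5 → Supertranslation K)
    (p : Fin 5 → ZMod 2) (hx : ∀ i, x i ∈ SuperSpace.part (Supertranslation K) (p i))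
    (hp : Finset.card {i | p i = 1} ≠ 4) :
    coboundary (fun x y => supertranslationBracket x y) (fun _ _ => 0) membraneCochain 0 x p =
      0 := by
  simp only [coboundary, smul_zero, Finset.sum_const_zero, zero_add]
  refine Finset.sum_eq_zero fun i _ => Finset.sum_eq_zero fun j _ => ?_
  split_ifs with hij
  swap
  · rfl
  suffices h : membraneCochain (Fin.cons (supertranslationBracket (x i.castSucc) (x j))
      fun t => x (j.succAbove (i.succAbove t)) : Fin 4 → Supertranslation K) = 0 by
    rw [h, smul_zero]
  by_cases hbr : supertranslationBracket (x i.castSucc) (x j) = 0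
  · exact membraneCochain.map_coord_zero 0 hbr
  have hpi : p i.castSucc = 1 := by
    refine (zmod_two_eq_zero_or_one _).resolve_left fun even => hbr ?_
    have hi : (x i.castSucc).2 = 0 := mem_part_zero.1 (even ▸ hx i.castSucc)
    rw [supertranslationBracket_apply, hi, spinorDot_zero_left, Prod.mk_zero_zero]
  have hpj : p j = 1 := by
    refine (zmod_two_eq_zero_or_one _).resolve_left fun even => hbr ?_
    have hj : (x j).2 = 0 := mem_part_zero.1 (even ▸ hx j)
    rw [supertranslationBracket_apply, hj, spinorDot_zero_right, Prod.mk_zero_zero]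
  refine membraneCochain_eq_zero _ (Fin.cons 0 fun t => p (j.succAbove (i.succAbove t)))
    (Fin.cases (mem_part_zero.2 rfl) fun t => hx _) ?_
  rw [Finset.card_filter, Fin.sum_univ_succAbove _ j, Fin.sum_univ_succAbove _ i,
    Fin.succAbove_of_castSucc_lt j i hij, hpi, hpj] at hp
  rw [Finset.card_filter, Fin.sum_univ_succ]
  simp only [Fin.cons_zero, Fin.cons_succ, zero_ne_one, if_true, if_false] at hp ⊢
  omega

theorem coboundary_membraneCochain_of_card_eq (x : Fin 5 → Supertranslation K)
    (p : Fin 5 → ZMod 2) (hx : ∀ i, x i ∈ SuperSpace.part (Supertranslation K) (p i))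
    (hp : Finset.card {i | p i = 1} = 4) :
    coboundary (fun x y => supertranslationBracket x y) (fun _ _ => 0) membraneCochain 0 x p =
      0 := by
  obtain ⟨k, rfl⟩ : ∃ k : Fin 5, p = fun i => if i = k then 0 else 1 := by
    clear hx
    revert p
    decide +kernel
  have even : (x k).2 = 0 := mem_part_zero.1 (by simpa using hx k)
  have odd (i) : (x (k.succAbove i)).1 = 0 := mem_part_one.1 (by simpa using hx (k.succAbove i))
  have identity := membraneForm_spinorDot_sum (x k).1 (x (k.succAbove 0)).2
    (x (k.succAbove 1)).2 (x (k.succAbove 2)).2 (x (k.succAbove 3)).2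
  clear hx hp
  fin_cases k <;> simp [Fin.succAbove, Fin.forall_fin_succ] at even odd identity <;>
    simp [coboundary, supertranslationBracket_apply, membraneCochain_cons_vec, Fin.succAbove,
      Fin.sum_univ_five, Fin.sum_univ_four, Finset.sum_filter, paritySign_zero, paritySign_one,
      paritySign_add, even, odd, spinorDot_zero_left, spinorDot_zero_right] <;>
    linarith

theorem isCocycle_membraneCochain :
    IsCocycle (fun x y => supertranslationBracket x y) (fun _ _ => 0)
      (membraneCochain (K := K)) 0 :=
  ⟨isMembraneForm_membraneCochain.isCochain, fun x p hx =>
    if hp : Finset.card {i | p i = 1} = 4 then coboundary_membraneCochain_of_card_eq x p hx hp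
    else coboundary_membraneCochain_of_card_ne x p hx hp⟩

end MembraneCochain

section DegreeZero

universe u

open LInftySuperalgebra

variable {V : ℕ → Type u} [∀ q, AddCommGroup (V q)] [∀ q, Module ℝ (V q)]

/-- The operation on `⨁ q, V q` that applies a multilinear map `V 0 × ⋯ × V 0 → V r` to the
components of degree `0`; its degree `r` is the number of arguments minus two. -/
noncomputable def degreeZeroOp {r : ℕ} (c : MultilinearMap ℝ (fun _ : Fin (r + 2) => V 0) (V r)) :
    MultilinearMap ℝ (fun _ : Fin (r + 2) => ⨁ q, V q) (⨁ q, V q) :=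
  (DirectSum.lof ℝ ℕ V r).compMultilinearMap
    (c.compLinearMap fun _ => DirectSum.component ℝ ℕ V 0)

theorem degreeZeroOp_apply {r : ℕ} (c : MultilinearMap ℝ (fun _ : Fin (r + 2) => V 0) (V r))
    (y : Fin (r + 2) → ⨁ q, V q) : degreeZeroOp c y = DirectSum.of V r (c fun i => y i 0) := rfl

theorem degreeZeroOp_of_apply_eq_zero {r : ℕ}
    (c : MultilinearMap ℝ (fun _ : Fin (r + 2) => V 0) (V r)) (q : Fin (r + 2) → ℕ)
    (x : ∀ i, V (q i)) (s : ℕ) (hs : s + 2 ≠ (∑ i, q i) + (r + 2)) :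
    degreeZeroOp c (fun i => DirectSum.of V (q i) (x i)) s = 0 := by
  rw [degreeZeroOp_apply]
  rcases ne_or_eq s r with hsr | rfl
  · exact DirectSum.of_eq_of_ne _ _ _ hsr
  obtain ⟨i, -, hi⟩ : ∃ i ∈ Finset.univ, q i ≠ 0 :=
    Finset.exists_ne_zero_of_sum_ne_zero (by omega)
  rw [DirectSum.of_eq_same]
  exact c.map_coord_zero i (DirectSum.of_eq_of_ne _ _ _ hi.symm)

/-- The operations `l (r + 2)` given by multilinear maps `c r` from `V 0` to `V r`. -/
noncomputable def cochainOp (c : ∀ r, MultilinearMap ℝ (fun _ : Fin (r + 2) => V 0) (V r)) :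
    ∀ k, MultilinearMap ℝ (fun _ : Fin k => ⨁ q, V q) (⨁ q, V q)
  | 0 | 1 => 0
  | r + 2 => degreeZeroOp (c r)

variable (c : ∀ r, MultilinearMap ℝ (fun _ : Fin (r + 2) => V 0) (V r))

theorem cochainOp_eq_zero {k : ℕ} (y : Fin k → ⨁ q, V q) (i : Fin k) (hi : y i 0 = 0) :
    cochainOp c k y = 0 := by
  match k with
  | 0 | 1 => rfl
  | r + 2 => exact (congrArg (DirectSum.of V r) ((c r).map_coord_zero i hi)).trans (map_zero _)

theorem cochainOp_apply_zero {k : ℕ} (hk : k ≠ 2) (y : Fin k → ⨁ q, V q) :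
    cochainOp c k y 0 = 0 := by
  match k with
  | 0 | 1 => rfl
  | r + 2 => exact DirectSum.of_eq_of_ne _ _ _ (by omega)

variable [∀ q, SuperSpace (V q)]

theorem of_apply_mem_part {q : ℕ} {p : ZMod 2} {x : V q} (hx : x ∈ SuperSpace.part (V q) p)
    (r : ℕ) : DirectSum.of V q x r ∈ SuperSpace.part (V r) p := by
  rcases ne_or_eq r q with h | rfl
  · rw [DirectSum.of_eq_of_ne _ _ _ h]
    exact Submodule.zero_mem _
  · rwa [DirectSum.of_eq_same]

theorem of_apply_zero_mem_part {q : ℕ} {p : ZMod 2} {x : V q} (hx : x ∈ SuperSpace.part (V q) p) :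
    DirectSum.of V q x 0 ∈ SuperSpace.part (V 0) (q + p) := by
  rcases q with _ | q
  · rw [Nat.cast_zero, zero_add]
    exact of_apply_mem_part hx 0
  · rw [DirectSum.of_eq_of_ne _ _ _ q.succ_ne_zero.symm]
    exact Submodule.zero_mem _

theorem sum_cochainOp_two {m : ℕ} {c}
    (hc : ∀ r, IsCocycle (fun x y => c 0 ![x, y]) (fun _ _ => 0) (c r) 0)
    (y : Fin (m + 2) → ⨁ q, V q) (d : Fin (m + 2) → ZMod 2)
    (hy : ∀ i, y i 0 ∈ SuperSpace.part (V 0) (d i)) :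
    ∑ σ : Equiv.Perm (Fin (m + 2)) with IsUnshuffle 2 σ,
      chi σ d • cochainOp c (m + 1) (Fin.cons (cochainOp c 2 ![y (σ 0), y (σ 1)])
        fun t => y (σ t.succ.succ)) = 0 := by
  match m with
  | 0 => exact Finset.sum_eq_zero fun σ _ => smul_zero _
  | m + 1 =>
    have cocycle := congrArg (DirectSum.lof ℝ ℕ V m) <|
      sum_isUnshuffle_eq_neg_coboundary (fun x y => c 0 ![x, y]) (c m) 0 (fun i => y i 0) d
    rw [(hc m).2 _ d hy, neg_zero, map_zero, map_sum] at cocycle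
    rw [← cocycle]
    refine Finset.sum_congr rfl fun σ _ => ?_
    rw [map_smul]
    refine congrArg _ (congrArg (DirectSum.of V m) (congrArg (c m) (funext fun t => ?_)))
    cases t using Fin.cases with
    | zero =>
      refine (DirectSum.of_eq_same _ _).trans (congrArg (c 0) (funext fun s => ?_))
      fin_cases s <;> rfl
    | succ t => rfl

theorem cochainOp_jacobi {c}
    (hc : ∀ r, IsCocycle (fun x y => c 0 ![x, y]) (fun _ _ => 0) (c r) 0)
    (n : ℕ) (q : Fin n → ℕ) (p : Fin n → ZMod 2) (x : ∀ i, V (q i))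
    (hx : ∀ i, x i ∈ SuperSpace.part (V (q i)) (p i)) :
    ∑ i : Fin n, ∑ σ : Equiv.Perm (Fin n) with IsUnshuffle (i + 1) σ,
      (chi σ (fun a => (q a : ZMod 2) + p a) * (-1 : ℝ) ^ (((i : ℕ) + 1) * (n - (i + 1)))) •
        cochainOp c (n - i) (fun t =>
          if (t : ℕ) = 0 then
            cochainOp c (i + 1) (fun s =>
              DirectSum.of V (q (σ ⟨s, by omega⟩)) (x (σ ⟨s, by omega⟩)))
          else
            DirectSum.of V (q (σ ⟨i + t, by omega⟩)) (x (σ ⟨i + t, by omega⟩))) = 0 := by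
  have inner_not_binary (i : Fin n) (hi : (i : ℕ) ≠ 1) (y : Fin (i + 1) → ⨁ q, V q)
      (z : Fin (n - i) → ⨁ q, V q) :
      cochainOp c (n - i) (fun t => if (t : ℕ) = 0 then cochainOp c (i + 1) y else z t) = 0 :=
    cochainOp_eq_zero c _ ⟨0, by omega⟩ (cochainOp_apply_zero c (by omega) y)
  match n with
  | 0 => rfl
  | 1 =>
    refine Finset.sum_eq_zero fun i _ => Finset.sum_eq_zero fun σ _ => ?_
    rw [inner_not_binary i (by omega), smul_zero]
  | m + 2 =>
    rw [Finset.sum_eq_single (⟨1, by omega⟩ : Fin (m + 2))]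
    · refine Eq.trans (Finset.sum_congr rfl fun σ _ => ?_) <|
        sum_cochainOp_two hc (fun i => DirectSum.of V (q i) (x i)) (fun a => q a + p a)
          fun i => of_apply_zero_mem_part (hx i)
      refine congrArg₂ (· • ·) (by simp [pow_mul])
        (congrArg (cochainOp c (m + 1)) (funext fun t => ?_))
      cases t using Fin.cases with
      | zero =>
        refine congrArg (cochainOp c 2) (funext fun s => ?_)
        fin_cases s <;> rfl
      | succ t =>
        exact (if_neg (Nat.succ_ne_zero _)).trans <|
          congrArg (fun j => DirectSum.of V (q (σ j)) (x (σ j))) (Fin.ext (Nat.add_comm _ _))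
    · intro i _ hi
      refine Finset.sum_eq_zero fun σ _ => ?_
      rw [inner_not_binary i (fun h => hi (Fin.ext h)), smul_zero]
    · exact fun h => absurd (Finset.mem_univ _) h

/-- The `L∞`-superalgebra with operations `l (r + 2) = c r` on `V 0`: here `c 0` is a Lie bracket
and the other `c r` are Chevalley-Eilenberg cocycles with trivial coefficients. -/
noncomputable def LInftySuperalgebra.ofCocycles
    (c : ∀ r, MultilinearMap ℝ (fun _ : Fin (r + 2) => V 0) (V r))
    (hc : ∀ r, IsCocycle (fun x y => c 0 ![x, y]) (fun _ _ => 0) (c r) 0) :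
    LInftySuperalgebra.{u} where
  V := V
  l := cochainOp c
  l_zero := rfl
  degree k q x r hr := by
    match k with
    | 0 | 1 => rfl
    | s + 2 => exact degreeZeroOp_of_apply_eq_zero (c s) q x r hr
  parity k q p x hx r := by
    match k with
    | 0 | 1 => exact Submodule.zero_mem _
    | s + 2 =>
      refine of_apply_mem_part ?_ r
      rw [← zero_add (∑ i, p i)]
      exact (hc s).1.parity _ p fun i => of_apply_mem_part (hx i) 0
  antisymm k q p x hx σ := by
    match k with
    | 0 | 1 => exact (smul_zero _).symm
    | s + 2 =>
      refine (congrArg (DirectSum.lof ℝ ℕ V s) ?_).trans (map_smul _ _ _)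
      exact (hc s).1.skew σ _ _ fun i => of_apply_zero_mem_part (hx i)
  jacobi := cochainOp_jacobi hc

namespace LInftySuperalgebra

variable {c} {hc : ∀ r, IsCocycle (fun x y => c 0 ![x, y]) (fun _ _ => 0) (c r) 0}

theorem ofCocycles_topCochain (r : ℕ) : (ofCocycles c hc).topCochain r = c r := by
  ext x
  refine (DirectSum.of_eq_same _ _).trans (congrArg (c r) (funext fun i => ?_))
  exact DirectSum.of_eq_same (β := V) 0 (x i)

theorem ofCocycles_bracket (x y : V 0) : (ofCocycles c hc).bracket x y = c 0 ![x, y] := by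
  refine (DirectSum.of_eq_same _ _).trans (congrArg (c 0) (funext fun i => ?_))
  fin_cases i
  · exact DirectSum.of_eq_same (β := V) 0 x
  · exact DirectSum.of_eq_same (β := V) 0 y

theorem ofCocycles_action {n : ℕ} (hn : n ≠ 0) (x : V 0) (f : V n) :
    (ofCocycles c hc).action n x f = (0 : V n) :=
  DirectSum.of_eq_of_ne _ _ _ hn

variable {V' : ℕ → Type u} [∀ q, AddCommGroup (V' q)] [∀ q, Module ℝ (V' q)]
  [∀ q, SuperSpace (V' q)] {c' : ∀ r, MultilinearMap ℝ (fun _ : Fin (r + 2) => V' 0) (V' r)}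
  {hc' : ∀ r, IsCocycle (fun x y => c' 0 ![x, y]) (fun _ _ => 0) (c' r) 0}

/-- The homomorphism given by parity-preserving linear maps that commute with the cocycles. -/
def Hom.ofCocycles (f : ∀ q, V q →ₗ[ℝ] V' q)
    (mem : ∀ q p, ∀ x ∈ SuperSpace.part (V q) p, f q x ∈ SuperSpace.part (V' q) p)
    (comm : ∀ r x, f r (c r x) = c' r fun i => f 0 (x i)) :
    Hom (ofCocycles c hc) (ofCocycles c' hc') where
  map := f
  map_mem := mem
  map_l k x := by
    match k with
    | 0 | 1 => exact map_zero _
    | r + 2 =>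
      refine (DirectSum.lmap_lof f r _).trans (congrArg (DirectSum.of V' r) ?_)
      exact (comm r _).trans <|
        congrArg (c' r) (funext fun i => (DirectSum.lmap_apply f (x i) 0).symm)

end LInftySuperalgebra

end DegreeZero

section BracketCochain

variable {g : Type*} [AddCommGroup g] [Module ℝ g] [LieSuperalgebra g]

variable (g) in
/-- The bracket of a Lie superalgebra as a `2`-cochain with values in the underlying space. -/
noncomputable def bracketCochain : MultilinearMap ℝ (fun _ : Fin 2 => g) g :=
  MultilinearMap.mk' (fun x => LieSuperalgebra.bracket (x 0) (x 1))
    (fun x i y z => by fin_cases i <;> simp)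
    (fun x i r y => by fin_cases i <;> simp)

theorem isCochain_bracketCochain : IsCochain (bracketCochain g) 0 where
  skew := skew_of_adjacent _ fun i x p hx => by
    obtain rfl : i = 0 := Subsingleton.elim _ _
    exact LieSuperalgebra.bracket_skew _ _ _ _ (hx 1) (hx 0) |>.trans
      (by rw [mul_comm]; rfl)
  parity x p hx := by
    rw [zero_add, Fin.sum_univ_two]
    exact LieSuperalgebra.bracket_mem _ _ _ _ (hx 0) (hx 1)

theorem coboundary_bracketCochain (x : Fin 3 → g) (p : Fin 3 → ZMod 2)
    (hx : ∀ i, x i ∈ SuperSpace.part g (p i)) :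
    coboundary (fun x y => LieSuperalgebra.bracket x y) (fun _ _ => 0) (bracketCochain g) 0 x p
      = 0 := by
  have expansion : coboundary (fun x y => LieSuperalgebra.bracket x y) (fun _ _ => 0)
      (bracketCochain g) 0 x p =
      -LieSuperalgebra.bracket (LieSuperalgebra.bracket (x 0) (x 1)) (x 2)
      + paritySign (p 1 * p 2) •
        LieSuperalgebra.bracket (LieSuperalgebra.bracket (x 0) (x 2)) (x 1)
      - paritySign ((p 1 + p 2) * p 0) •
        LieSuperalgebra.bracket (LieSuperalgebra.bracket (x 1) (x 2)) (x 0) := by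
    have succAbove_two : Fin.succAbove (2 : Fin 3) 1 = 1 := rfl
    rcases zmod_two_eq_zero_or_one (p 0) with h₀ | h₀ <;>
    rcases zmod_two_eq_zero_or_one (p 1) with h₁ | h₁ <;>
    rcases zmod_two_eq_zero_or_one (p 2) with h₂ | h₂ <;>
    simp [coboundary, Fin.sum_univ_succ, Finset.sum_filter, bracketCochain, succAbove_two,
      h₀, h₁, h₂, paritySign_add, paritySign_zero, paritySign_one, pow_succ, sub_eq_add_neg]
  rw [expansion, LieSuperalgebra.bracket_skew (p 1 + p 2) (p 0) _ _
      (LieSuperalgebra.bracket_mem _ _ _ _ (hx 1) (hx 2)) (hx 0),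
    LieSuperalgebra.bracket_skew (p 0 + p 2) (p 1) _ _
      (LieSuperalgebra.bracket_mem _ _ _ _ (hx 0) (hx 2)) (hx 1),
    LieSuperalgebra.jacobi (p 0) (p 1) (x 0) (x 1) (x 2) (hx 0) (hx 1)]
  rw [smul_neg, smul_neg, smul_smul, smul_smul, paritySign_mul_self, add_mul, paritySign_add,
    mul_comm (p 1) (p 2), mul_left_comm, paritySign_mul_self]
  module

theorem isCocycle_bracketCochain :
    IsCocycle (fun x y => LieSuperalgebra.bracket x y) (fun _ _ => 0) (bracketCochain g) 0 :=
  ⟨isCochain_bracketCochain, coboundary_bracketCochain⟩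

end BracketCochain

theorem isCocycle_zero {g R : Type*} [AddCommGroup g] [Module ℝ g] [SuperSpace g]
    [AddCommGroup R] [Module ℝ R] [SuperSpace R] (br : g → g → g) {n : ℕ} (s : ZMod 2) :
    IsCocycle br (fun _ _ => 0) (0 : MultilinearMap ℝ (fun _ : Fin (n + 1) => g) R) s :=
  ⟨⟨fun _ _ _ _ => (smul_zero _).symm, fun _ _ _ => Submodule.zero_mem _⟩,
    fun _ _ _ => by simp [coboundary]⟩

section TwoTerm

universe u

instance : SuperSpace PUnit.{u + 1} := ⟨⊤, ⊥, isCompl_top_bot⟩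

instance : LieSuperalgebra PUnit.{u + 1} where
  bracket := 0
  bracket_mem _ _ _ _ _ _ := Submodule.zero_mem _
  bracket_skew _ _ _ _ _ _ := rfl
  jacobi _ _ _ _ _ _ _ := rfl

/-- The graded vector space with `W₀` in degree `0` and `W₂` in degree `2`. -/
def TwoTerm (W₀ W₂ : Type u) : ℕ → Type u
  | 0 => W₀
  | 1 => PUnit
  | 2 => W₂
  | _ + 3 => PUnit

namespace TwoTerm

variable (W₀ W₂ : Type u) [AddCommGroup W₀] [AddCommGroup W₂]

instance : ∀ q, AddCommGroup (TwoTerm W₀ W₂ q)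
  | 0 => inferInstanceAs (AddCommGroup W₀)
  | 1 => inferInstanceAs (AddCommGroup PUnit.{u + 1})
  | 2 => inferInstanceAs (AddCommGroup W₂)
  | _ + 3 => inferInstanceAs (AddCommGroup PUnit.{u + 1})

variable [Module ℝ W₀] [Module ℝ W₂]

instance : ∀ q, Module ℝ (TwoTerm W₀ W₂ q)
  | 0 => inferInstanceAs (Module ℝ W₀)
  | 1 => inferInstanceAs (Module ℝ PUnit.{u + 1})
  | 2 => inferInstanceAs (Module ℝ W₂)
  | _ + 3 => inferInstanceAs (Module ℝ PUnit.{u + 1})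

instance [SuperSpace W₀] [SuperSpace W₂] : ∀ q, SuperSpace (TwoTerm W₀ W₂ q)
  | 0 => inferInstanceAs (SuperSpace W₀)
  | 1 => inferInstanceAs (SuperSpace PUnit.{u + 1})
  | 2 => inferInstanceAs (SuperSpace W₂)
  | _ + 3 => inferInstanceAs (SuperSpace PUnit.{u + 1})

end TwoTerm

theorem TwoTerm.subsingleton (W₀ W₂ : Type u) :
    ∀ q, q ≠ 0 → q ≠ 2 → Subsingleton (TwoTerm W₀ W₂ q)
  | 0, h, _ => absurd rfl h
  | 2, _, h => absurd rfl h
  | 1, _, _ | _ + 3, _, _ => inferInstanceAs (Subsingleton PUnit)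

section FourCocycle

variable {g R : Type u} [AddCommGroup g] [Module ℝ g] [LieSuperalgebra g]
  [AddCommGroup R] [Module ℝ R] [SuperSpace R]

/-- The family consisting of the bracket of `g` and the `4`-cochain `ω`, from which
`LInftySuperalgebra.ofFourCocycle` is built. -/
noncomputable def TwoTerm.cochain (ω : MultilinearMap ℝ (fun _ : Fin 4 => g) R) :
    ∀ r, MultilinearMap ℝ (fun _ : Fin (r + 2) => TwoTerm g R 0) (TwoTerm g R r)
  | 0 => bracketCochain g
  | 1 => 0
  | 2 => ω
  | _ + 3 => 0

theorem TwoTerm.isCocycle_cochain {ω : MultilinearMap ℝ (fun _ : Fin 4 => g) R}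
    (hω : IsCocycle (fun x y => LieSuperalgebra.bracket x y) (fun _ _ => 0) ω 0) :
    ∀ r, IsCocycle (fun x y => cochain ω 0 ![x, y]) (fun _ _ => 0) (cochain ω r) 0
  | 0 => isCocycle_bracketCochain (g := g)
  | 1 => isCocycle_zero _ _
  | 2 => hω
  | _ + 3 => isCocycle_zero _ _

namespace LInftySuperalgebra

/-- The Lie `3`-superalgebra with `g` in degree `0`, `R` in degree `2` and `l 4 = ω`. -/
noncomputable def ofFourCocycle (ω : MultilinearMap ℝ (fun _ : Fin 4 => g) R)
    (hω : IsCocycle (fun x y => LieSuperalgebra.bracket x y) (fun _ _ => 0) ω 0) :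
    LInftySuperalgebra.{u} :=
  ofCocycles (TwoTerm.cochain ω) (TwoTerm.isCocycle_cochain hω)

variable {ω : MultilinearMap ℝ (fun _ : Fin 4 => g) R}
  (hω : IsCocycle (fun x y => LieSuperalgebra.bracket x y) (fun _ _ => 0) ω 0)

theorem ofFourCocycle_isLieSuperalgebra : (ofFourCocycle ω hω).IsLieSuperalgebra 3 := fun q hq =>
  TwoTerm.subsingleton g R q (by omega) (by omega)

theorem ofFourCocycle_isTwoTerm : (ofFourCocycle ω hω).IsTwoTerm 2 :=
  ⟨TwoTerm.subsingleton g R, rfl⟩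

theorem ofFourCocycle_bracket (x y : g) :
    (ofFourCocycle ω hω).bracket x y = LieSuperalgebra.bracket x y :=
  ofCocycles_bracket (hc := TwoTerm.isCocycle_cochain hω) x y

theorem ofFourCocycle_action (x : g) (r : R) : (ofFourCocycle ω hω).action 2 x r = (0 : R) :=
  ofCocycles_action (hc := TwoTerm.isCocycle_cochain hω) two_ne_zero x r

theorem ofFourCocycle_topCochain : (ofFourCocycle ω hω).topCochain 2 = ω :=
  ofCocycles_topCochain (hc := TwoTerm.isCocycle_cochain hω) 2

theorem ofFourCocycle_correspondsTo :
    (ofFourCocycle ω hω).CorrespondsTo 2 (SuperRepresentation.trivial g R) ω :=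
  ⟨ofFourCocycle_isTwoTerm hω, LinearEquiv.refl ℝ g, LinearEquiv.refl ℝ R,
    fun _ _ => Iff.rfl, fun _ _ => Iff.rfl, ofFourCocycle_bracket hω, ofFourCocycle_action hω,
    fun x => congrArg (fun η => η x) (ofFourCocycle_topCochain hω)⟩

theorem isTrivialCocycle_of_isExact_ofFourCocycle (h : (ofFourCocycle ω hω).IsExact 2) :
    IsTrivialCocycle (fun x y : g => LieSuperalgebra.bracket x y) (fun _ _ => 0) ω := by
  have bracket_eq : (ofFourCocycle ω hω).bracket = fun x y : g => LieSuperalgebra.bracket x y :=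
    funext₂ (ofFourCocycle_bracket hω)
  have action_eq : (ofFourCocycle ω hω).action 2 = fun (_ : g) (_ : R) => (0 : R) :=
    funext₂ (ofFourCocycle_action hω)
  have trivial := h.2.2
  rw [bracket_eq, action_eq, ofFourCocycle_topCochain hω] at trivial
  exact trivial

end LInftySuperalgebra

end FourCocycle

end TwoTerm

section Extension

universe u

variable {W₀ W₂ W₀' W₂' : Type u} [AddCommGroup W₀] [Module ℝ W₀] [AddCommGroup W₂] [Module ℝ W₂]
  [AddCommGroup W₀'] [Module ℝ W₀'] [AddCommGroup W₂'] [Module ℝ W₂']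

/-- The map of graded vector spaces with components `f₀` and `f₂` in degrees `0` and `2`. -/
def TwoTerm.map (f₀ : W₀ →ₗ[ℝ] W₀') (f₂ : W₂ →ₗ[ℝ] W₂') :
    ∀ q, TwoTerm W₀ W₂ q →ₗ[ℝ] TwoTerm W₀' W₂' q
  | 0 => f₀
  | 1 => 0
  | 2 => f₂
  | _ + 3 => 0

theorem TwoTerm.map_mem_part [SuperSpace W₀] [SuperSpace W₂] [SuperSpace W₀'] [SuperSpace W₂']
    {f₀ : W₀ →ₗ[ℝ] W₀'} {f₂ : W₂ →ₗ[ℝ] W₂'}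
    (h₀ : ∀ p, ∀ x ∈ SuperSpace.part W₀ p, f₀ x ∈ SuperSpace.part W₀' p)
    (h₂ : ∀ p, ∀ x ∈ SuperSpace.part W₂ p, f₂ x ∈ SuperSpace.part W₂' p) :
    ∀ q p, ∀ x ∈ SuperSpace.part (TwoTerm W₀ W₂ q) p,
      map f₀ f₂ q x ∈ SuperSpace.part (TwoTerm W₀' W₂' q) p
  | 0, p, x, hx => h₀ p x hx
  | 1, _, _, _ => Submodule.zero_mem _
  | 2, p, x, hx => h₂ p x hx
  | _ + 3, _, _, _ => Submodule.zero_mem _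

namespace LInftySuperalgebra

variable {g g' R R' : Type u} [AddCommGroup g] [Module ℝ g] [LieSuperalgebra g]
  [AddCommGroup g'] [Module ℝ g'] [LieSuperalgebra g']
  [AddCommGroup R] [Module ℝ R] [SuperSpace R] [AddCommGroup R'] [Module ℝ R'] [SuperSpace R']
  {ω : MultilinearMap ℝ (fun _ : Fin 4 => g) R} {ω' : MultilinearMap ℝ (fun _ : Fin 4 => g') R'}
  {hω : IsCocycle (fun x y => LieSuperalgebra.bracket x y) (fun _ _ => 0) ω 0}
  {hω' : IsCocycle (fun x y => LieSuperalgebra.bracket x y) (fun _ _ => 0) ω' 0}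

/-- The homomorphism given by a homomorphism of Lie superalgebras and an even linear map of
coefficients that intertwine the cocycles. -/
noncomputable def Hom.ofFourCocycle {f₀ : g →ₗ[ℝ] g'} {f₂ : R →ₗ[ℝ] R'}
    (h₀ : ∀ p, ∀ x ∈ SuperSpace.part g p, f₀ x ∈ SuperSpace.part g' p)
    (h₂ : ∀ p, ∀ x ∈ SuperSpace.part R p, f₂ x ∈ SuperSpace.part R' p)
    (map_bracket : ∀ x y, f₀ (LieSuperalgebra.bracket x y) = LieSuperalgebra.bracket (f₀ x) (f₀ y))
    (map_cocycle : ∀ x, f₂ (ω x) = ω' fun i => f₀ (x i)) :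
    Hom (LInftySuperalgebra.ofFourCocycle ω hω) (LInftySuperalgebra.ofFourCocycle ω' hω') :=
  Hom.ofCocycles (TwoTerm.map f₀ f₂) (TwoTerm.map_mem_part h₀ h₂) fun
    | 0, x => map_bracket (x 0) (x 1)
    | 1, _ => rfl
    | 2, x => map_cocycle x
    | _ + 3, _ => rfl

variable (g R)

/-- The Lie superalgebra `g` in degree `0`. -/
noncomputable def ofLie : LInftySuperalgebra.{u} :=
  ofFourCocycle (g := g) (R := PUnit) 0 (isCocycle_zero _ _)

/-- The `L∞`-superalgebra `b²R`. -/
noncomputable def shiftTwo : LInftySuperalgebra.{u} :=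
  ofFourCocycle (g := PUnit) (R := R) 0 (isCocycle_zero _ _)

theorem ofLie_isOfLie : (ofLie g).IsOfLie g := by
  refine ⟨fun q hq => ?_, LinearEquiv.refl ℝ g, fun _ _ => Iff.rfl, ofFourCocycle_bracket _⟩
  obtain rfl | h := eq_or_ne q 2
  · exact inferInstanceAs (Subsingleton PUnit)
  · exact TwoTerm.subsingleton g PUnit q hq h

theorem shiftTwo_isShift : (shiftTwo R).IsShift R 2 := by
  refine ⟨fun q hq => ?_, fun k => ?_, LinearEquiv.refl ℝ R, fun _ _ => Iff.rfl⟩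
  · obtain rfl | h := eq_or_ne q 0
    · exact inferInstanceAs (Subsingleton PUnit)
    · exact TwoTerm.subsingleton PUnit R q h hq
  · match k with
    | 0 | 1 => rfl
    | r + 2 =>
      have cochain_eq_zero : TwoTerm.cochain (g := PUnit) (R := R) 0 r = 0 := by
        match r with
        | 0 | 1 | 2 | _ + 3 => rfl
      exact MultilinearMap.ext fun y =>
        (congrArg (fun c => degreeZeroOp c y) cochain_eq_zero).trans (map_zero (DirectSum.of _ r))

variable {g R} (hω)

/-- The first map of the extension `0 → b²R → ofFourCocycle ω → g → 0`. -/
noncomputable def shiftTwoInclusion : Hom (shiftTwo R) (ofFourCocycle ω hω) :=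
  Hom.ofFourCocycle (f₀ := 0) (f₂ := LinearMap.id) (fun _ _ _ => Submodule.zero_mem _)
    (fun _ _ h => h) (fun _ _ => (map_zero _).symm) fun _ => ω.map_zero.symm

/-- The second map of the extension `0 → b²R → ofFourCocycle ω → g → 0`. -/
noncomputable def projectionToLie : Hom (ofFourCocycle ω hω) (ofLie g) :=
  Hom.ofFourCocycle (f₀ := LinearMap.id) (f₂ := 0) (fun _ _ h => h)
    (fun _ _ _ => Submodule.zero_mem _) (fun _ _ => rfl) fun _ => rfl

theorem ofFourCocycle_isExtension : (ofFourCocycle ω hω).IsExtension 2 g R := by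
  refine ⟨shiftTwo R, ofLie g, shiftTwoInclusion hω, projectionToLie hω, shiftTwo_isShift R,
    ofLie_isOfLie g, ?_⟩
  rintro (_ | _ | _ | q)
  · exact ⟨Function.injective_of_subsingleton (α := PUnit) _,
      (LinearMap.exact_zero_iff_injective PUnit.{u + 1} (LinearMap.id : g →ₗ[ℝ] g)).2
        Function.injective_id,
      Function.surjective_id⟩
  · exact ⟨Function.injective_id, fun _ => ⟨fun _ => ⟨PUnit.unit, rfl⟩, fun _ => rfl⟩,
      Function.surjective_id⟩
  · exact ⟨Function.injective_id,
      (LinearMap.exact_zero_iff_surjective PUnit.{u + 1} (LinearMap.id : R →ₗ[ℝ] R)).2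
        Function.surjective_id,
      fun _ => ⟨(0 : R), rfl⟩⟩
  · exact ⟨fun _ _ _ => rfl, fun _ => ⟨fun _ => ⟨PUnit.unit, rfl⟩, fun _ => rfl⟩,
      fun _ => ⟨PUnit.unit, rfl⟩⟩

end LInftySuperalgebra

end Extension

section PairwiseCommuting

variable {g R : Type*} [AddCommGroup g] [Module ℝ g] [AddCommGroup R] [Module ℝ R] {n : ℕ}

theorem coboundary_eq_zero_of_bracket_eq_zero (br : g → g → g)
    (ω : MultilinearMap ℝ (fun _ : Fin (n + 1) => g) R) (s : ZMod 2) {x : Fin (n + 2) → g}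
    (p : Fin (n + 2) → ZMod 2) (hx : ∀ i j, i < j → br (x i) (x j) = 0) :
    coboundary br (fun _ _ => 0) ω s x p = 0 := by
  simp only [coboundary, smul_zero, Finset.sum_const_zero, zero_add]
  refine Finset.sum_eq_zero fun i _ => Finset.sum_eq_zero fun j _ => ?_
  split_ifs with hij
  · rw [hx _ _ hij, ω.map_coord_zero 0 (Fin.cons_zero _ _), smul_zero]
  · rfl

theorem not_isTrivialCocycle_of_bracket_eq_zero [SuperSpace g] [SuperSpace R] {br : g → g → g}
    {ω : MultilinearMap ℝ (fun _ : Fin (n + 2) => g) R} {x : Fin (n + 2) → g}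
    {p : Fin (n + 2) → ZMod 2} (hp : ∀ i, x i ∈ SuperSpace.part g (p i))
    (hx : ∀ i j, i < j → br (x i) (x j) = 0) (hω : ω x ≠ 0) :
    ¬ IsTrivialCocycle br (fun _ _ => 0) ω := by
  rintro ⟨θ₀, θ₁, -, -, h⟩
  apply hω
  rw [h x p hp, coboundary_eq_zero_of_bracket_eq_zero br θ₀ 0 p hx,
    coboundary_eq_zero_of_bracket_eq_zero br θ₁ 1 p hx, add_zero]

end PairwiseCommuting

section Nontriviality

variable {K : Type*} [NonAssocRing K] [StarRing K] [Module ℝ K] [IsScalarTower ℝ K K]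
  [SMulCommClass ℝ K K] [StarModule ℝ K] [NormedDivisionAlgebra K]

open NormedDivisionAlgebra (re)

theorem spinorDot_inl_inr_eq_zero :
    spinorDot (Sum.elim ![1, 0] 0 : Spinor K) (Sum.elim 0 ![0, 1]) = 0 := by
  refine Prod.ext (by simp [spinorDot, dotProduct]) (Subtype.ext ?_)
  ext i j
  simp [spinorDot, hermOuter, traceReversal, Matrix.trace]

/-- The vector given by the hermitian matrix with zero diagonal and off-diagonal entries `1`. -/
def offDiagonalVec : Vec K :=
  (0, ⟨!![0, 1; 1, 0], by
    change star _ = _; ext i j; fin_cases i <;> fin_cases j <;> simp [Matrix.star_apply]⟩)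

theorem membraneForm_offDiagonalVec :
    membraneForm (0, ⟨1, star_one _⟩) (offDiagonalVec : Vec K) (Sum.elim ![1, 0] 0)
      (Sum.elim 0 ![0, 1]) = -2 := by
  have re_two : re (2 : K) = 2 := by
    rw [← one_add_one_eq_two, map_add, re_one, one_add_one_eq_two]
  rw [membraneForm_eq_sub]
  norm_num [spinorPairing_apply, cliffordAction, offDiagonalVec, Vec.toMatrix, Matrix.mulVec,
    dotProduct, traceReversal, Matrix.trace, Matrix.one_apply, re_one, re_two]

theorem not_isTrivialCocycle_membraneCochain :
    ¬ IsTrivialCocycle (fun x y : Supertranslation K => LieSuperalgebra.bracket x y)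
      (fun _ _ => (0 : ℝ)) membraneCochain := by
  refine not_isTrivialCocycle_of_bracket_eq_zero (p := ![1, 1, 0, 0])
    (x := ![(0, Sum.elim ![1, 0] 0), (0, Sum.elim 0 ![0, 1]), ((0, ⟨1, star_one _⟩), 0),
      (offDiagonalVec, 0)]) (fun i => ?_) (fun i j hij => ?_) ?_
  · fin_cases i
    exacts [mem_part_one.2 rfl, mem_part_one.2 rfl, mem_part_zero.2 rfl, mem_part_zero.2 rfl]
  · change supertranslationBracket _ _ = 0
    rw [supertranslationBracket_apply]
    fin_cases i <;> fin_cases j <;>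
      first
      | exact absurd hij (by decide)
      | simp [spinorDot_inl_inr_eq_zero, spinorDot_zero_right]
  · rw [isMembraneForm_membraneCochain.apply, ← membraneForm_apply, membraneForm_offDiagonalVec]
    norm_num

end Nontriviality

theorem finrank_vec_examples :
    Module.finrank ℝ (Vec ℝ) = 4 ∧ Module.finrank ℝ (Vec ℂ) = 5 ∧
      Module.finrank ℝ (Vec ℍ[ℝ]) = 7 ∧ Module.finrank ℝ (Vec Octonion) = 11 := by
  simp only [finrank_vec, Module.finrank_self, Complex.finrank_real_complex,
    Quaternion.finrank_eq_four, finrank_octonion, Nat.reduceAdd, and_self]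

/-- Existence of the non-exact Lie 3-superalgebra extending the supertranslation algebra, in
spacetime dimensions 4, 5, 7 and 11 (for the reals, complexes, quaternions and octonions). -/
theorem mainTheorem9 :
    (Module.finrank ℝ (Vec ℝ) = 4 ∧ Module.finrank ℝ (Vec ℂ) = 5 ∧
      Module.finrank ℝ (Vec ℍ[ℝ]) = 7 ∧ Module.finrank ℝ (Vec Octonion) = 11) ∧
    ∀ (K : Type) [NonAssocRing K] [StarRing K] [Module ℝ K] [IsScalarTower ℝ K K]
      [SMulCommClass ℝ K K] [StarModule ℝ K] [NormedDivisionAlgebra K],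
      Module.finrank ℝ (Vec K) = Module.finrank ℝ K + 3 ∧
      ∃ β : MultilinearMap ℝ (fun _ : Fin 4 => Supertranslation K) ℝ,
        (∀ β', IsMembraneForm β' ↔ β' = β) ∧
        IsCocycle (fun x y => LieSuperalgebra.bracket x y)
          (fun x r => (SuperRepresentation.trivial (Supertranslation K) ℝ).map x r) β 0 ∧
        ∃ L : LInftySuperalgebra.{0},
          L.IsLieSuperalgebra 3 ∧
          L.CorrespondsTo 2 (SuperRepresentation.trivial (Supertranslation K) ℝ) β ∧
          ¬ L.IsExact 2 ∧
          L.IsExtension 2 (Supertranslation K) ℝ := by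
  refine ⟨finrank_vec_examples, fun K => ?_⟩
  intros
  exact ⟨finrank_vec, membraneCochain,
    fun _ => ⟨fun h => h.unique isMembraneForm_membraneCochain,
      fun h => h ▸ isMembraneForm_membraneCochain⟩,
    isCocycle_membraneCochain,
    LInftySuperalgebra.ofFourCocycle membraneCochain isCocycle_membraneCochain,
    LInftySuperalgebra.ofFourCocycle_isLieSuperalgebra _,
    LInftySuperalgebra.ofFourCocycle_correspondsTo _,
    mt (LInftySuperalgebra.isTrivialCocycle_of_isExact_ofFourCocycle _)
      not_isTrivialCocycle_membraneCochain,
    LInftySuperalgebra.ofFourCocycle_isExtension _⟩
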